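/- **Setting.** Profits lie in $[0,1]$, efforts in $[0,\bar e]$ with $\bar e>0$. For each $e\in[0,\bar e]$, $\phi(\cdot|e)$ is a probability density on $[0,1]$ with $\phi(x|e)>0$ for all $x\in[0,1]$; it is differentiable in $e$ with derivative $\phi_e(x|e)$ (one-sided at the endpoints), and $|\phi_e(x|e)|\le g(x)$ for all $x,e$, for some $g$ integrable on $[0,1]$. The effort cost $C\ge 0$ is differentiable on $[0,\bar e]$; $I>0$ and $r>0$. A *security* is a nondecreasing right-continuous $H:[0,1]\to\mathbb{R}$ with $0\le H(x)\le x$. Let $$U(H,e)=\int_0^1 (x-H(x))\phi(x|e)\,dx-C(e).$$ The *entrepreneur's problem* is to maximize $U(H,e)$ over securities $H$ and efforts $e\in[0,\bar e]$ subject to $$\int_0^1 (x-H(x))\phi_e(x|e)\,dx=C'(e)\quad(\mathrm{FOC}),\qquad \int_0^1 H(x)\phi(x|e)\,dx\ge(1+r)I\quad(\mathrm{IR}).$$ A security *solves* the problem if it attains the maximum together with some effort. A security $H$ is a *contingent debt contract* with $k$ face values if there are $k$ nonempty intervals $[\underline x_n,\overline x_n)$ with $\underline x_n\in[0,1]$ such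 that $H$ is constant on $[\underline x_n,\overline x_n)\cap[0,1]$, $H(x)=x$ for $x\in[0,1]$ outside their union, and the face values $d_n=H(\underline x_n)$ are pairwise distinct. The face value $d_n$ is *non-defaultable* if $d_n<x$ for all $x\in[\underline x_n,\overline x_n)\cap[0,1]$. A function on $[0,1]$ is *$n$-peaked* if there are $n$ disjoint intervals in $[0,1]$ on each of which it is nondecreasing while it is nonincreasing on each interval contained in the complement of their union; it is *at most $N$-peaked* if it is $n$-peaked for some $n\le N$. **Proposition 4.** Suppose that, for every $e\in[0,\bar e]$, $(1+r)I$ lies in the interior of $$\Big\{\int_0^1 H(x)\phi(x|e)\,dx \;:\; H \text{ a security},\ \int_0^1 (x-H(x))\phi_e(x|e)\,dx=C'(e)\Big\}.$$ 1. If $N\in\mathbb{N}$ is such that $\phi_e(\cdot|e)/\phi(\cdot|e)$ is at most $N$-peaked for every $e\in[0,\bar e]$, then some contingent debt contract with at most $N+1$ face values, at most two of them non-defaultable, solves the entrepreneur's problem. 2. If the densities satisfy the monotone likelihood ratio property ($\phi(x|e')/\phi(x|e)$ is nondecreasing in $x\in[0,1]$ whenever $e\le e'$), then there is $d>0$ such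 that the standard debt contract $H^d(x)=\min\{x,d\}$ solves the entrepreneur's problem in which (FOC) is replaced by $e\in\arg\max_{t\in[0,\bar e]}U(H,t)$. If in addition, for every security $H$, every maximizer of $U(H,\cdot)$ on $[0,\bar e]$ satisfies (FOC), then $H^d$ also solves the entrepreneur's problem with (FOC). -/

import Mathlib

open Set MeasureTheory

noncomputable section

namespace SecurityDesign

/-- A security on profits in `[0,1]`: nondecreasing, right-continuous, and between `0` and the
profit. Values of `H` outside `[0,1]` are irrelevant. -/
structure IsSecurity (H : ℝ → ℝ) : Prop where
  mono : MonotoneOn H (Icc 0 1)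
  rightCont : ∀ x ∈ Ico (0 : ℝ) 1, ContinuousWithinAt H (Ici x) x
  nonneg : ∀ x ∈ Icc (0 : ℝ) 1, 0 ≤ H x
  le_self : ∀ x ∈ Icc (0 : ℝ) 1, H x ≤ x

/-- The moral hazard environment. `density x e` is the density of the profit `x ∈ [0,1]` under
effort `e ∈ [0, maxEffort]`, `densityDeriv` its derivative in `e`, `cost` the effort cost and
`costDeriv` its derivative (one-sided at the two ends of the effort interval). -/
structure Model where
  maxEffort : ℝ
  density : ℝ → ℝ → ℝ
  densityDeriv : ℝ → ℝ → ℝ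
  cost : ℝ → ℝ
  costDeriv : ℝ → ℝ
  investment : ℝ
  rate : ℝ
  maxEffort_pos : 0 < maxEffort
  investment_pos : 0 < investment
  rate_pos : 0 < rate
  density_pos : ∀ x ∈ Icc (0 : ℝ) 1, ∀ e ∈ Icc 0 maxEffort, 0 < density x e
  density_integrable : ∀ e ∈ Icc 0 maxEffort,
    IntegrableOn (fun x => density x e) (Icc 0 1) volume
  density_integral : ∀ e ∈ Icc 0 maxEffort, ∫ x in (0 : ℝ)..1, density x e = 1
  density_hasDeriv : ∀ x ∈ Icc (0 : ℝ) 1, ∀ e ∈ Icc 0 maxEffort,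
    HasDerivWithinAt (fun t => density x t) (densityDeriv x e) (Icc 0 maxEffort) e
  densityDeriv_dominated : ∃ g : ℝ → ℝ, IntegrableOn g (Icc 0 1) volume ∧
    ∀ x ∈ Icc (0 : ℝ) 1, ∀ e ∈ Icc 0 maxEffort, |densityDeriv x e| ≤ g x
  cost_nonneg : ∀ e ∈ Icc 0 maxEffort, 0 ≤ cost e
  cost_hasDeriv : ∀ e ∈ Icc 0 maxEffort,
    HasDerivWithinAt cost (costDeriv e) (Icc 0 maxEffort) e

namespace Model

variable (M : Model)

/-- The return `(1 + r) I` required by the investor. -/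
def requiredReturn : ℝ := (1 + M.rate) * M.investment

/-- The investor's expected return from the security `H` under effort `e`. -/
def investorReturn (H : ℝ → ℝ) (e : ℝ) : ℝ := ∫ x in (0 : ℝ)..1, H x * M.density x e

/-- The entrepreneur's expected payoff. -/
def payoff (H : ℝ → ℝ) (e : ℝ) : ℝ :=
  (∫ x in (0 : ℝ)..1, (x - H x) * M.density x e) - M.cost e

/-- The first-order condition of the entrepreneur's effort choice. -/
def FirstOrder (H : ℝ → ℝ) (e : ℝ) : Prop :=
  ∫ x in (0 : ℝ)..1, (x - H x) * M.densityDeriv x e = M.costDeriv e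

/-- Given the security `H`, the effort `e` maximizes the entrepreneur's payoff over
`[0, maxEffort]`. -/
def BestResponse (H : ℝ → ℝ) (e : ℝ) : Prop :=
  e ∈ Icc 0 M.maxEffort ∧ ∀ t ∈ Icc 0 M.maxEffort, M.payoff H t ≤ M.payoff H e

/-- Every solution of the effort problem, for any security, satisfies the first-order condition. -/
def FirstOrderNecessary : Prop :=
  ∀ H e, IsSecurity H → M.BestResponse H e → M.FirstOrder H e

/-- Feasibility of a security and an effort when incentive compatibility means `IC`. -/
structure Feasible (IC : (ℝ → ℝ) → ℝ → Prop) (H : ℝ → ℝ) (e : ℝ) : Prop where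
  security : IsSecurity H
  effort_mem : e ∈ Icc 0 M.maxEffort
  incentive : IC H e
  participation : M.requiredReturn ≤ M.investorReturn H e

/-- `(H, e)` maximizes the entrepreneur's payoff among the feasible pairs. -/
def Optimal (IC : (ℝ → ℝ) → ℝ → Prop) (H : ℝ → ℝ) (e : ℝ) : Prop :=
  M.Feasible IC H e ∧ ∀ G t, M.Feasible IC G t → M.payoff G t ≤ M.payoff H e

/-- The security `H`, with some effort, solves the entrepreneur's problem whose incentive
constraint is the first-order condition. -/
def SolvesProblem (H : ℝ → ℝ) : Prop := ∃ e, M.Optimal M.FirstOrder H e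

/-- The security `H`, with some effort, solves the entrepreneur's problem whose incentive
constraint is that the effort is a best response to the security. -/
def SolvesBestResponseProblem (H : ℝ → ℝ) : Prop := ∃ e, M.Optimal M.BestResponse H e

/-- For every effort `e`, the required return is interior to the set of the expected returns of
the securities that satisfy the first-order condition at `e`. -/
def RequiredReturnInterior : Prop :=
  ∀ e ∈ Icc 0 M.maxEffort, M.requiredReturn ∈
    interior {y : ℝ | ∃ H, IsSecurity H ∧ M.FirstOrder H e ∧ M.investorReturn H e = y}

/-- The monotone likelihood ratio property. -/
def MLRP : Prop :=
  ∀ e ∈ Icc 0 M.maxEffort, ∀ t ∈ Icc 0 M.maxEffort, e ≤ t →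
    MonotoneOn (fun x => M.density x t / M.density x e) (Icc 0 1)

end Model

/-- `ρ` is `n`-peaked on `[0,1]`: there are `n` disjoint intervals on each of which `ρ` is
increasing, and `ρ` is decreasing on each interval of the complement of their union. -/
def IsPeaked (n : ℕ) (ρ : ℝ → ℝ) : Prop :=
  ∃ I : Fin n → Set ℝ, (∀ k, (I k).OrdConnected) ∧ (∀ k, I k ⊆ Icc 0 1) ∧
    Pairwise (fun j k => Disjoint (I j) (I k)) ∧ (∀ k, MonotoneOn ρ (I k)) ∧
    ∀ J : Set ℝ, J.OrdConnected → J ⊆ Icc 0 1 \ ⋃ k, I k → AntitoneOn ρ J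

/-- `ρ` is at most `N`-peaked. -/
def IsAtMostPeaked (N : ℕ) (ρ : ℝ → ℝ) : Prop := ∃ n ≤ N, IsPeaked n ρ

/-- `H` is a contingent debt contract with the intervals `[lo n, hi n)`, read inside `[0,1]`, and
the pairwise distinct face values `H (lo n)`. The number of face values is the size of `ι`. -/
structure IsContingentDebt {ι : Type} [Countable ι] (H : ℝ → ℝ) (lo hi : ι → ℝ) : Prop where
  security : IsSecurity H
  lo_mem : ∀ n, lo n ∈ Icc (0 : ℝ) 1
  lo_lt_hi : ∀ n, lo n < hi n
  const : ∀ n, ∀ x ∈ Ico (lo n) (hi n) ∩ Icc 0 1, H x = H (lo n)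
  eq_self : ∀ x ∈ Icc (0 : ℝ) 1, (∀ n, x ∉ Ico (lo n) (hi n)) → H x = x
  distinct : Function.Injective (fun n => H (lo n))

/-- The `n`-th face value is below every profit at which it is in effect. -/
def NonDefaultable {ι : Type} (H : ℝ → ℝ) (lo hi : ι → ℝ) (n : ι) : Prop :=
  ∀ x ∈ Ico (lo n) (hi n) ∩ Icc 0 1, H (lo n) < x

/-- Standard debt with face value `d`. -/
def standardDebt (d : ℝ) : ℝ → ℝ := fun x => min x d

end SecurityDesign

end

/-!
Whatever the security, the entrepreneur obtains the surplus of the effort less the investor's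
return. A feasible pair is therefore optimal as soon as its effort maximizes the surplus and the
investor receives exactly the required return.

For the first part, take a security `H` that meets both constraints with equality at such an effort.
Where `φ_e / φ` is nonincreasing, replacing `H` by debt of the same mean raises the integral against
`φ_e`; where it is nondecreasing, so does paying the cap up to a threshold and the next claim beyond
it. With as many caps as stretches this gives a capped claim that has the mean of `H` and a larger
integral against `φ_e`, and with `-φ_e` one that has a smaller integral. Moving caps and thresholds
from one to the other along claims of this mean, the intermediate value theorem yields a capped
claim with both integrals of `H`. Among the caps with these two integrals choose those with the
largest sum of squares: three caps free to move in both directions could be moved without affecting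
the two integrals, against strict convexity.

For the second part, choose the debt that returns the required amount at maximal effort. Its return
increases with effort, so at lower efforts it returns no more than a security `K` satisfying the
first-order condition there. Since `K` crosses the debt plus a nonnegative constant once from below,
the debt gives more incentives than `K`: the entrepreneur's payoff increases with effort, and so
does the surplus.
-/

namespace SecurityDesign

section Integrals

variable {a b : ℝ} {D f w φ ψ : ℝ → ℝ}

theorem abs_le_max_abs_of_monotoneOn (hf : MonotoneOn f (Icc a b)) {x : ℝ} (hx : x ∈ Icc a b) :
    |f x| ≤ max |f a| |f b| :=
  abs_le_max_abs_abs (hf (left_mem_Icc.2 (hx.1.trans hx.2)) hx hx.1)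
    (hf hx (right_mem_Icc.2 (hx.1.trans hx.2)) hx.2)

theorem intervalIntegrable_mul_of_monotoneOn (hf : MonotoneOn f (uIcc a b))
    (hw : IntervalIntegrable w volume a b) :
    IntervalIntegrable (fun x => f x * w x) volume a b := by
  rw [intervalIntegrable_iff] at hw ⊢
  have hmeas : AEStronglyMeasurable f (volume.restrict (uIoc a b)) :=
    (aemeasurable_restrict_of_monotoneOn measurableSet_uIoc
      (hf.mono uIoc_subset_uIcc)).aestronglyMeasurable
  refine hw.bdd_mul (c := max |f (min a b)| |f (max a b)|) hmeas ?_
  filter_upwards [ae_restrict_mem measurableSet_uIoc] with x hx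
  exact abs_le_max_abs_of_monotoneOn hf (uIoc_subset_uIcc hx)

theorem integral_mul_eq_zero_of_nonneg (hab : a ≤ b) (hφ : ∀ x ∈ Ioo a b, 0 < φ x)
    (hD : ∀ x ∈ Ioo a b, 0 ≤ D x) (hDφ : IntervalIntegrable (fun x => D x * φ x) volume a b)
    (h0 : ∫ x in a..b, D x * φ x = 0) : ∫ x in a..b, D x * ψ x = 0 := by
  rw [intervalIntegral.integral_of_le hab, integral_Ioc_eq_integral_Ioo] at h0 ⊢
  rw [setIntegral_eq_zero_iff_of_nonneg_ae
    (ae_restrict_of_forall_mem measurableSet_Ioo fun x hx => mul_nonneg (hD x hx) (hφ x hx).le)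
    ((intervalIntegrable_iff_integrableOn_Ioo_of_le hab).1 hDφ)] at h0
  refine integral_eq_zero_of_ae ?_
  filter_upwards [h0, ae_restrict_mem measurableSet_Ioo] with x hx hmem
  rw [(mul_eq_zero.1 hx).resolve_right (hφ x hmem).ne', zero_mul, Pi.zero_apply]

theorem integral_mul_eq_of_le (hab : a ≤ b) (hφ : ∀ x ∈ Ioo a b, 0 < φ x)
    (hDf : ∀ x ∈ Ioo a b, D x ≤ f x)
    (hDφ : IntervalIntegrable (fun x => D x * φ x) volume a b)
    (hfφ : IntervalIntegrable (fun x => f x * φ x) volume a b)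
    (hDψ : IntervalIntegrable (fun x => D x * ψ x) volume a b)
    (hfψ : IntervalIntegrable (fun x => f x * ψ x) volume a b)
    (h : ∫ x in a..b, D x * φ x = ∫ x in a..b, f x * φ x) :
    ∫ x in a..b, D x * ψ x = ∫ x in a..b, f x * ψ x := by
  have hzero := integral_mul_eq_zero_of_nonneg (D := fun x => f x - D x) (ψ := ψ) hab hφ
    (fun x hx => sub_nonneg.2 (hDf x hx)) (by simpa only [sub_mul] using hfφ.sub hDφ)
    (by simp only [sub_mul, intervalIntegral.integral_sub hfφ hDφ, h, sub_self])
  simp only [sub_mul, intervalIntegral.integral_sub hfψ hDψ] at hzero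
  linarith

/-- `D` changes sign at most once along `s`, from negative to positive. -/
def SingleCrossingOn (D : ℝ → ℝ) (s : Set ℝ) : Prop :=
  ∀ x ∈ s, ∀ y ∈ s, x ≤ y → 0 < D x → 0 ≤ D y

theorem SingleCrossingOn.exists_sign_change {s : Set ℝ} (h : SingleCrossingOn D s)
    [s.OrdConnected] {x y : ℝ} (hx : x ∈ s) (hDx : D x < 0) (hy : y ∈ s) (hDy : 0 < D y) :
    ∃ t ∈ s, (∀ z ∈ s, z < t → D z ≤ 0) ∧ ∀ z ∈ s, t < z → 0 ≤ D z := by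
  have hlower : x ∈ lowerBounds {z ∈ s | 0 < D z} := fun z hz =>
    le_of_not_ge fun hzx => (h z hz.1 x hx hzx hz.2).not_gt hDx
  have hmem : y ∈ {z ∈ s | 0 < D z} := ⟨hy, hDy⟩
  refine ⟨sInf {z ∈ s | 0 < D z},
    Set.OrdConnected.out ‹_› hx hy ⟨le_csInf ⟨y, hmem⟩ hlower, csInf_le ⟨x, hlower⟩ hmem⟩,
    fun z hz hlt => not_lt.1 fun hpos => hlt.not_ge (csInf_le ⟨x, hlower⟩ ⟨hz, hpos⟩),
    fun z hz hlt => ?_⟩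
  obtain ⟨u, ⟨hu, hDu⟩, huz⟩ := exists_lt_of_csInf_lt ⟨y, hmem⟩ hlt
  exact h u hu z hz huz.le hDu

theorem SingleCrossingOn.integral_mul_nonneg (hD : SingleCrossingOn D (Ioo a b)) (hab : a ≤ b)
    (hφ : ∀ x ∈ Ioo a b, 0 < φ x) (hρ : MonotoneOn (fun x => ψ x / φ x) (Ioo a b))
    (hDφ : IntervalIntegrable (fun x => D x * φ x) volume a b)
    (hDψ : IntervalIntegrable (fun x => D x * ψ x) volume a b)
    (h0 : ∫ x in a..b, D x * φ x = 0) : 0 ≤ ∫ x in a..b, D x * ψ x := by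
  by_cases hnonneg : ∀ x ∈ Ioo a b, 0 ≤ D x
  · exact (integral_mul_eq_zero_of_nonneg hab hφ hnonneg hDφ h0).ge
  by_cases hnonpos : ∀ x ∈ Ioo a b, D x ≤ 0
  · have hneg := integral_mul_eq_zero_of_nonneg (D := fun x => -D x) (ψ := ψ) hab hφ
      (fun x hx => neg_nonneg.2 (hnonpos x hx)) (by simpa only [neg_mul, Pi.neg_def] using hDφ.neg)
      (by simp only [neg_mul, intervalIntegral.integral_neg, h0, neg_zero])
    simp only [neg_mul, intervalIntegral.integral_neg, neg_eq_zero] at hneg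
    exact hneg.ge
  push Not at hnonneg hnonpos
  obtain ⟨x, hx, hDx⟩ := hnonneg
  obtain ⟨y, hy, hDy⟩ := hnonpos
  obtain ⟨t, ht, hbefore, hafter⟩ := hD.exists_sign_change hx hDx hy hDy
  -- Subtracting the multiple `ψ t / φ t` of the vanishing integral makes the integrand nonnegative.
  calc 0 ≤ ∫ x in a..b, (D x * ψ x - ψ t / φ t * (D x * φ x)) := by
        rw [intervalIntegral.integral_of_le hab, integral_Ioc_eq_integral_Ioo]
        refine setIntegral_nonneg measurableSet_Ioo fun z hz => ?_
        have hfactor : D z * ψ z - ψ t / φ t * (D z * φ z)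
            = D z * (ψ z / φ z - ψ t / φ t) * φ z := by
          have := (hφ z hz).ne'
          field_simp
        rw [hfactor]
        refine mul_nonneg ?_ (hφ z hz).le
        rcases lt_trichotomy z t with hzt | rfl | htz
        · exact mul_nonneg_of_nonpos_of_nonpos (hbefore z hz hzt) (sub_nonpos.2 (hρ hz ht hzt.le))
        · rw [sub_self, mul_zero]
        · exact mul_nonneg (hafter z hz htz) (sub_nonneg.2 (hρ ht hz htz.le))
    _ = ∫ x in a..b, D x * ψ x := by
        rw [intervalIntegral.integral_sub hDψ (hDφ.const_mul _),
          intervalIntegral.integral_const_mul, h0, mul_zero, sub_zero]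

end Integrals

section Securities

variable {H K w φ ψ : ℝ → ℝ} {a b c : ℝ}

theorem isSecurity_id : IsSecurity fun x => x where
  mono := monotoneOn_id
  rightCont _ _ := continuousWithinAt_id
  nonneg _ hx := hx.1
  le_self _ _ := le_rfl

theorem isSecurity_standardDebt (hc : 0 ≤ c) : IsSecurity (standardDebt c) where
  mono _ _ _ _ hxy := min_le_min_right c hxy
  rightCont _ _ := (continuous_id.min continuous_const).continuousWithinAt
  nonneg _ hx := le_min hx.1 hc
  le_self _ _ := min_le_left _ _

/-- On `[a, b]` the claims `K` and `H` have the same mean for the density `φ`, while `K` has the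
larger integral against `ψ`, the effort derivative of the density in the applications. -/
def ImprovesOn (φ ψ : ℝ → ℝ) (a b : ℝ) (K H : ℝ → ℝ) : Prop :=
  (∫ x in a..b, K x * φ x = ∫ x in a..b, H x * φ x) ∧
    ∫ x in a..b, H x * ψ x ≤ ∫ x in a..b, K x * ψ x

theorem improvesOn_self : ImprovesOn φ ψ a a K H := by
  simp only [ImprovesOn, intervalIntegral.integral_same, le_refl, and_self]

theorem ImprovesOn.congr_left {K' : ℝ → ℝ} (h : ImprovesOn φ ψ a b K H) (hab : a ≤ b)
    (heq : EqOn K' K (Ioo a b)) : ImprovesOn φ ψ a b K' H := by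
  have hcongr (w : ℝ → ℝ) : ∫ x in a..b, K' x * w x = ∫ x in a..b, K x * w x :=
    intervalIntegral.integral_congr_Ioo_of_le hab fun x hx => by simp only [heq hx]
  rwa [ImprovesOn, hcongr, hcongr]

namespace IsSecurity

theorem mem_Icc (hH : IsSecurity H) {x : ℝ} (hx : x ∈ Icc (0 : ℝ) 1) : H x ∈ Icc (0 : ℝ) 1 :=
  ⟨hH.nonneg x hx, (hH.le_self x hx).trans hx.2⟩

theorem intervalIntegrable_mul (hH : IsSecurity H) (hw : IntervalIntegrable w volume 0 1)
    (ha : a ∈ Icc (0 : ℝ) 1) (hb : b ∈ Icc (0 : ℝ) 1) :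
    IntervalIntegrable (fun x => H x * w x) volume a b := by
  have hsub : uIcc a b ⊆ uIcc 0 1 := by
    rw [uIcc_of_le (zero_le_one' ℝ)]
    exact uIcc_subset_Icc ha hb
  exact (intervalIntegrable_mul_of_monotoneOn
    (by simpa only [uIcc_of_le (zero_le_one' ℝ)] using hH.mono) hw).mono_set hsub

theorem integral_mul_mono (hH : IsSecurity H) (hK : IsSecurity K)
    (hφ : IntervalIntegrable φ volume 0 1) (hφ0 : ∀ x ∈ Ioo a b, 0 ≤ φ x)
    (ha : a ∈ Icc (0 : ℝ) 1) (hb : b ∈ Icc (0 : ℝ) 1) (hab : a ≤ b)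
    (hle : ∀ x ∈ Ioo a b, H x ≤ K x) :
    ∫ x in a..b, H x * φ x ≤ ∫ x in a..b, K x * φ x :=
  intervalIntegral.integral_mono_on_of_le_Ioo hab (hH.intervalIntegrable_mul hφ ha hb)
    (hK.intervalIntegrable_mul hφ ha hb)
    fun x hx => mul_le_mul_of_nonneg_right (hle x hx) (hφ0 x hx)

theorem integral_sub_mul (hH : IsSecurity H) (hK : IsSecurity K)
    (hw : IntervalIntegrable w volume 0 1) (ha : a ∈ Icc (0 : ℝ) 1) (hb : b ∈ Icc (0 : ℝ) 1) :
    ∫ x in a..b, (H x - K x) * w x = (∫ x in a..b, H x * w x) - ∫ x in a..b, K x * w x := by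
  simp only [sub_mul]
  exact intervalIntegral.integral_sub (hH.intervalIntegrable_mul hw ha hb)
    (hK.intervalIntegrable_mul hw ha hb)

theorem improvesOn_of_singleCrossingOn (hH : IsSecurity H) (hK : IsSecurity K)
    (hφi : IntervalIntegrable φ volume 0 1) (hψi : IntervalIntegrable ψ volume 0 1)
    (hφ : ∀ x ∈ Ioo a b, 0 < φ x)
    (ha : a ∈ Icc (0 : ℝ) 1) (hb : b ∈ Icc (0 : ℝ) 1) (hab : a ≤ b)
    (hρ : MonotoneOn (fun x => ψ x / φ x) (Ioo a b))
    (hcross : SingleCrossingOn (fun x => K x - H x) (Ioo a b))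
    (heq : ∫ x in a..b, K x * φ x = ∫ x in a..b, H x * φ x) : ImprovesOn φ ψ a b K H := by
  have hint {v : ℝ → ℝ} (hv : IntervalIntegrable v volume 0 1) :
      IntervalIntegrable (fun x => (K x - H x) * v x) volume a b := by
    simpa only [sub_mul] using
      (hK.intervalIntegrable_mul hv ha hb).sub (hH.intervalIntegrable_mul hv ha hb)
  refine ⟨heq, ?_⟩
  rw [← sub_nonneg, ← hK.integral_sub_mul hH hψi ha hb]
  exact hcross.integral_mul_nonneg hab hφ hρ (hint hφi) (hint hψi)
    (by rw [hK.integral_sub_mul hH hφi ha hb, heq, sub_self])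

theorem integral_add_adjacent (hH : IsSecurity H) (hw : IntervalIntegrable w volume 0 1)
    (ha : a ∈ Icc (0 : ℝ) 1) (hb : b ∈ Icc (0 : ℝ) 1) (hc : c ∈ Icc (0 : ℝ) 1) :
    (∫ x in a..b, H x * w x) + ∫ x in b..c, H x * w x = ∫ x in a..c, H x * w x :=
  intervalIntegral.integral_add_adjacent_intervals (hH.intervalIntegrable_mul hw ha hb)
    (hH.intervalIntegrable_mul hw hb hc)

end IsSecurity

theorem ImprovesOn.add_adjacent (hab : ImprovesOn φ ψ a b K H) (hbc : ImprovesOn φ ψ b c K H)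
    (hK : IsSecurity K) (hH : IsSecurity H) (hφ : IntervalIntegrable φ volume 0 1)
    (hψ : IntervalIntegrable ψ volume 0 1) (ha : a ∈ Icc (0 : ℝ) 1) (hb : b ∈ Icc (0 : ℝ) 1)
    (hc : c ∈ Icc (0 : ℝ) 1) : ImprovesOn φ ψ a c K H := by
  rw [ImprovesOn, ← hK.integral_add_adjacent hφ ha hb hc, ← hK.integral_add_adjacent hψ ha hb hc,
    ← hH.integral_add_adjacent hφ ha hb hc, ← hH.integral_add_adjacent hψ ha hb hc]
  exact ⟨congrArg₂ (· + ·) hab.1 hbc.1, add_le_add hab.2 hbc.2⟩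

theorem continuousOn_integral_mul_of_isSecurity {X : Type*} [TopologicalSpace X]
    [FirstCountableTopology X] {S : Set X} {h : X → ℝ → ℝ} (hS : ∀ p ∈ S, IsSecurity (h p))
    (hc : ∀ p ∈ S, ∀ᵐ x, x ∈ Icc (0 : ℝ) 1 → ContinuousWithinAt (fun q => h q x) S p)
    (hw : IntervalIntegrable w volume 0 1) (ha : a ∈ Icc (0 : ℝ) 1) (hb : b ∈ Icc (0 : ℝ) 1) :
    ContinuousOn (fun p => ∫ x in a..b, h p x * w x) S := by
  intro p hp
  have hsub : uIoc a b ⊆ Icc 0 1 := uIoc_subset_uIcc.trans (uIcc_subset_Icc ha hb)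
  have hsub' : uIcc a b ⊆ uIcc 0 1 := by
    rw [uIcc_of_le (zero_le_one' ℝ)]
    exact uIcc_subset_Icc ha hb
  refine intervalIntegral.continuousWithinAt_of_dominated_interval (bound := fun x => |w x|)
    ?_ ?_ (hw.mono_set hsub').abs ?_
  · filter_upwards [self_mem_nhdsWithin] with q hq
    exact (intervalIntegrable_iff.1 ((hS q hq).intervalIntegrable_mul hw ha hb)).1
  · filter_upwards [self_mem_nhdsWithin] with q hq
    refine Filter.Eventually.of_forall fun x hx => ?_
    obtain ⟨h0, h1⟩ := (hS q hq).mem_Icc (hsub hx)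
    rw [norm_mul, Real.norm_eq_abs, Real.norm_eq_abs, abs_of_nonneg h0]
    exact mul_le_of_le_one_left (abs_nonneg _) h1
  · filter_upwards [hc p hp] with x hx hxab
    exact (hx (hsub hxab)).mul continuousWithinAt_const

theorem continuousOn_integral_standardDebt_mul (hw : IntervalIntegrable w volume 0 1)
    (ha : a ∈ Icc (0 : ℝ) 1) (hb : b ∈ Icc (0 : ℝ) 1) :
    ContinuousOn (fun c => ∫ x in a..b, standardDebt c x * w x) (Ici 0) :=
  continuousOn_integral_mul_of_isSecurity (fun _ hc => isSecurity_standardDebt hc)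
    (fun _ _ => Filter.Eventually.of_forall fun _ _ =>
      (continuous_const.min continuous_id).continuousWithinAt) hw ha hb

theorem IsSecurity.exists_standardDebt_integral_eq (hH : IsSecurity H)
    (hφi : IntervalIntegrable φ volume 0 1) (hφ : ∀ x ∈ Ioo a b, 0 ≤ φ x)
    (ha : a ∈ Icc (0 : ℝ) 1) (hb : b ∈ Icc (0 : ℝ) 1) (hab : a ≤ b) :
    ∃ c ∈ Icc (H a) (H b),
      ∫ x in a..b, standardDebt c x * φ x = ∫ x in a..b, H x * φ x := by
  have hbounds {x : ℝ} (hx : x ∈ Ioo a b) : x ∈ Icc (0 : ℝ) 1 ∧ H a ≤ H x ∧ H x ≤ H b := by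
    have hx01 : x ∈ Icc (0 : ℝ) 1 := ⟨ha.1.trans hx.1.le, hx.2.le.trans hb.2⟩
    exact ⟨hx01, hH.mono ha hx01 hx.1.le, hH.mono hx01 hb hx.2.le⟩
  have hlow := (isSecurity_standardDebt (hH.nonneg a ha)).integral_mul_mono hH hφi hφ ha hb hab
    fun x hx => (min_le_right _ _).trans (hbounds hx).2.1
  have hhigh := hH.integral_mul_mono (isSecurity_standardDebt (hH.nonneg b hb)) hφi hφ ha hb hab
    fun x hx => le_min (hH.le_self x (hbounds hx).1) (hbounds hx).2.2
  exact intermediate_value_Icc (hH.mono ha hb hab)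
    ((continuousOn_integral_standardDebt_mul hφi ha hb).mono fun c hc =>
      (hH.nonneg a ha).trans hc.1) ⟨hlow, hhigh⟩

theorem IsSecurity.singleCrossingOn_sub_standardDebt (hK : IsSecurity K) (hc : 0 ≤ c) (d : ℝ) :
    SingleCrossingOn (fun x => K x - (standardDebt d x + c)) (Icc 0 1) := by
  intro x hx y hy hxy hpos
  have hKx : standardDebt d x + c < K x := sub_pos.1 hpos
  have hdx : standardDebt d x = d := (min_choice x d).resolve_left fun hmin => by
    have := hK.le_self x hx
    rw [standardDebt, hmin] at hKx
    linarith
  rw [hdx] at hKx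
  have hdy : standardDebt d y ≤ d := min_le_right _ _
  have := hK.mono hx hy hxy
  linarith

theorem IsSecurity.exists_standardDebt_improvesOn (hH : IsSecurity H)
    (hφi : IntervalIntegrable φ volume 0 1) (hψi : IntervalIntegrable ψ volume 0 1)
    (hφ : ∀ x ∈ Ioo a b, 0 < φ x) (ha : a ∈ Icc (0 : ℝ) 1) (hb : b ∈ Icc (0 : ℝ) 1) (hab : a ≤ b)
    (hρ : AntitoneOn (fun x => ψ x / φ x) (Ioo a b)) :
    ∃ c ∈ Icc (H a) (H b), ImprovesOn φ ψ a b (standardDebt c) H := by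
  obtain ⟨c, hc, heq⟩ :=
    hH.exists_standardDebt_integral_eq hφi (fun x hx => (hφ x hx).le) ha hb hab
  have hcross : SingleCrossingOn (fun x => H x - standardDebt c x) (Ioo a b) := by
    intro x hx y hy
    simpa only [add_zero] using hH.singleCrossingOn_sub_standardDebt le_rfl c
      x ⟨ha.1.trans hx.1.le, hx.2.le.trans hb.2⟩ y ⟨ha.1.trans hy.1.le, hy.2.le.trans hb.2⟩
  have hdebt : IsSecurity (standardDebt c) := isSecurity_standardDebt ((hH.nonneg a ha).trans hc.1)
  have hneg := (hdebt.improvesOn_of_singleCrossingOn (ψ := fun x => -ψ x) hH hφi hψi.neg hφ ha hb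
    hab (by simpa only [neg_div] using hρ.neg) hcross heq.symm).2
  simp only [mul_neg, intervalIntegral.integral_neg, neg_le_neg_iff] at hneg
  exact ⟨c, hc, heq, hneg⟩

end Securities

section CappedClaim

/-- The claim that pays the profit, capped at `c i` as long as the profit is below `t i`. Contingent
debt contracts are represented this way because every choice of `t` and of `c ≥ 0`, in whatever
order, gives a security. -/
noncomputable def cappedClaim {ι : Type*} [Fintype ι] (t c : ι → ℝ) (x : ℝ) : ℝ :=
  Finset.univ.fold min x fun i => if x < t i then c i else x

variable {ι : Type*} [Fintype ι] {t t' c c' : ι → ℝ} {x y : ℝ}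

theorem le_cappedClaim_iff : y ≤ cappedClaim t c x ↔ y ≤ x ∧ ∀ i, x < t i → y ≤ c i := by
  rw [cappedClaim, Finset.le_fold_min]
  refine and_congr_right fun hyx => forall_congr' fun i => ?_
  split_ifs with hi <;> simp [hi, hyx]

theorem cappedClaim_le_self : cappedClaim t c x ≤ x := (le_cappedClaim_iff.1 le_rfl).1

theorem cappedClaim_le {i : ι} (hi : x < t i) : cappedClaim t c x ≤ c i :=
  (le_cappedClaim_iff.1 le_rfl).2 i hi

theorem cappedClaim_eq_self_or :
    cappedClaim t c x = x ∨ ∃ i, x < t i ∧ cappedClaim t c x = c i := by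
  rcases (Finset.fold_min_le _).1 (le_refl (cappedClaim t c x)) with hx | ⟨i, -, hi⟩
  · exact Or.inl (cappedClaim_le_self.antisymm hx)
  · split_ifs at hi with hxi
    · exact Or.inr ⟨i, hxi, (cappedClaim_le hxi).antisymm hi⟩
    · exact Or.inl (cappedClaim_le_self.antisymm hi)

theorem monotone_cappedClaim : Monotone (cappedClaim t c) := fun _ _ hxy =>
  le_cappedClaim_iff.2
    ⟨cappedClaim_le_self.trans hxy, fun _ hi => cappedClaim_le (hxy.trans_lt hi)⟩

theorem cappedClaim_mono_param (ht : ∀ i, t' i ≤ t i) (hc : ∀ i, c i ≤ c' i) :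
    cappedClaim t c x ≤ cappedClaim t' c' x :=
  le_cappedClaim_iff.2 ⟨cappedClaim_le_self,
    fun i hi => (cappedClaim_le (hi.trans_le (ht i))).trans (hc i)⟩

theorem cappedClaim_cons {n : ℕ} {t c : Fin n → ℝ} {s c₀ : ℝ} (hc : ∀ i, c₀ ≤ c i) :
    cappedClaim (Fin.cons s t : Fin (n + 1) → ℝ) (Fin.cons c₀ c) x
      = if x < s then standardDebt c₀ x else cappedClaim t c x := by
  refine eq_of_forall_le_iff fun y => ?_
  simp only [le_cappedClaim_iff, Fin.forall_fin_succ, Fin.cons_zero, Fin.cons_succ]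
  split_ifs with hxs
  · rw [standardDebt, le_min_iff]
    exact and_congr_right fun _ =>
      ⟨fun h => h.1 hxs, fun h => ⟨fun _ => h, fun i _ => h.trans (hc i)⟩⟩
  · simp only [hxs, false_imp_iff, true_and, le_cappedClaim_iff]

theorem continuousWithinAt_cappedClaim {Z : Type*} [TopologicalSpace Z] {S : Set Z} {z₀ : Z}
    {x : Z → ℝ} {t c : Z → ι → ℝ} (hx : ContinuousWithinAt x S z₀)
    (hc : ContinuousWithinAt c S z₀)
    (ht : ∀ i, ∀ᶠ z in nhdsWithin z₀ S, (x z < t z i ↔ x z₀ < t z₀ i)) :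
    ContinuousWithinAt (fun z => cappedClaim (t z) (c z) (x z)) S z₀ := by
  have hpay (i : ι) : ContinuousWithinAt (fun z => if x z < t z i then c z i else x z) S z₀ := by
    by_cases hi : x z₀ < t z₀ i
    · refine ((continuous_apply i).continuousAt.comp_continuousWithinAt hc).congr_of_eventuallyEq ?_
        (if_pos hi)
      filter_upwards [ht i] with z hz using if_pos (hz.2 hi)
    · refine hx.congr_of_eventuallyEq ?_ (if_neg hi)
      filter_upwards [ht i] with z hz using if_neg (mt hz.1 hi)
  classical
  have hfold (s : Finset ι) : ContinuousWithinAt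
      (fun z => s.fold min (x z) fun i => if x z < t z i then c z i else x z) S z₀ := by
    induction s using Finset.induction_on with
    | empty => simpa only [Finset.fold_empty] using hx
    | insert i s hi ih =>
      simp only [Finset.fold_insert hi]
      exact (hpay i).min ih
  exact hfold Finset.univ

theorem isSecurity_cappedClaim (hc : ∀ i, 0 ≤ c i) : IsSecurity (cappedClaim t c) where
  mono := monotone_cappedClaim.monotoneOn _
  rightCont x _ := by
    refine continuousWithinAt_cappedClaim continuousWithinAt_id continuousWithinAt_const fun i => ?_
    rcases lt_or_ge x (t i) with hi | hi
    · filter_upwards [nhdsWithin_le_nhds (Iio_mem_nhds hi)] with y hy using iff_of_true hy hi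
    · filter_upwards [self_mem_nhdsWithin] with y hy
      exact iff_of_false (hi.trans hy).not_gt hi.not_gt
  nonneg _ hx := le_cappedClaim_iff.2 ⟨hx.1, fun i _ => hc i⟩
  le_self _ _ := cappedClaim_le_self

theorem continuousOn_integral_cappedClaim_mul {w : ℝ → ℝ} {a b : ℝ}
    (hw : IntervalIntegrable w volume 0 1) (ha : a ∈ Icc (0 : ℝ) 1) (hb : b ∈ Icc (0 : ℝ) 1) :
    ContinuousOn (fun p : (ι → ℝ) × (ι → ℝ) => ∫ x in a..b, cappedClaim p.1 p.2 x * w x)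
      {p | ∀ i, 0 ≤ p.2 i} := by
  refine continuousOn_integral_mul_of_isSecurity (fun p hp => isSecurity_cappedClaim hp)
    (fun p _ => ?_) hw ha hb
  have hne : ∀ᵐ x : ℝ, ∀ i, x ≠ p.1 i :=
    ae_all_iff.2 fun i => Measure.ae_ne volume (p.1 i)
  filter_upwards [hne] with x hx _
  refine continuousWithinAt_cappedClaim continuousWithinAt_const continuousWithinAt_snd fun i => ?_
  have hcont : ContinuousAt (fun q : (ι → ℝ) × (ι → ℝ) => q.1 i) p :=
    ((continuous_apply i).comp continuous_fst).continuousAt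
  refine nhdsWithin_le_nhds ?_
  rcases (hx i).lt_or_gt with hi | hi
  · filter_upwards [hcont.eventually (Ioi_mem_nhds hi)] with q hq using iff_of_true hq hi
  · filter_upwards [hcont.eventually (Iio_mem_nhds hi)] with q hq
    exact iff_of_false (le_of_lt hq).not_gt hi.le.not_gt

end CappedClaim

section Alternation

variable {H φ ψ ρ : ℝ → ℝ} {a b r c₀ : ℝ} {n : ℕ}

theorem IsSecurity.exists_cappedClaim_switch {t c : Fin n → ℝ} (hH : IsSecurity H)
    (hφi : IntervalIntegrable φ volume 0 1) (hψi : IntervalIntegrable ψ volume 0 1)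
    (hφ : ∀ x ∈ Ioo a b, 0 < φ x) (ha : a ∈ Icc (0 : ℝ) 1) (hb : b ∈ Icc (0 : ℝ) 1) (hab : a ≤ b)
    (hρ : MonotoneOn (fun x => ψ x / φ x) (Ioo a b)) (hc₀ : 0 ≤ c₀) (hc : ∀ i, c₀ ≤ c i)
    (hlow : ∀ x ∈ Ioo a b, standardDebt c₀ x ≤ H x)
    (hhigh : ∀ x ∈ Ioo a b, H x ≤ cappedClaim t c x) :
    ∃ s ∈ Icc a b, ImprovesOn φ ψ a b
      (cappedClaim (Fin.cons s t : Fin (n + 1) → ℝ) (Fin.cons c₀ c)) H := by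
  have hcaps : ∀ i, 0 ≤ (Fin.cons c₀ c : Fin (n + 1) → ℝ) i :=
    Fin.forall_fin_succ.2 ⟨hc₀, fun i => hc₀.trans (hc i)⟩
  have hK (s : ℝ) : IsSecurity (cappedClaim (Fin.cons s t : Fin (n + 1) → ℝ) (Fin.cons c₀ c)) :=
    isSecurity_cappedClaim hcaps
  have hφ0 : ∀ x ∈ Ioo a b, 0 ≤ φ x := fun x hx => (hφ x hx).le
  have hcont : ContinuousOn (fun s =>
      ∫ x in a..b, cappedClaim (Fin.cons s t : Fin (n + 1) → ℝ) (Fin.cons c₀ c) x * φ x)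
      (Icc a b) :=
    (continuousOn_integral_cappedClaim_mul hφi ha hb).comp (t := {p | ∀ i, 0 ≤ p.2 i})
      (f := fun s => ((Fin.cons s t : Fin (n + 1) → ℝ), (Fin.cons c₀ c : Fin (n + 1) → ℝ)))
      ((Continuous.finCons (A := fun _ => ℝ) continuous_id continuous_const).prodMk
        continuous_const).continuousOn
      fun _ _ => hcaps
  obtain ⟨s, hs, heq⟩ := intermediate_value_Icc' hab hcont
    ⟨(hK b).integral_mul_mono hH hφi hφ0 ha hb hab fun x hx => by
        rw [cappedClaim_cons hc, if_pos hx.2]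
        exact hlow x hx,
      hH.integral_mul_mono (hK a) hφi hφ0 ha hb hab fun x hx => by
        rw [cappedClaim_cons hc, if_neg hx.1.not_gt]
        exact hhigh x hx⟩
  refine ⟨s, hs, hH.improvesOn_of_singleCrossingOn (hK s) hφi hψi hφ ha hb hab hρ ?_ heq⟩
  intro x hx y hy hxy hpos
  simp only [cappedClaim_cons hc] at hpos ⊢
  rcases lt_or_ge x s with hxs | hsx
  · rw [if_pos hxs] at hpos
    exact absurd (hlow x hx) (sub_pos.1 hpos).not_ge
  · rw [if_neg (hsx.trans hxy).not_gt]
    exact sub_nonneg.2 (hhigh y hy)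

/-- `Alternates ρ n r`: on `[r, 1]` the function `ρ` alternates `n` times between an antitone and a
monotone stretch, in this order and ignoring its values at the ends of the stretches. A stretch may
be empty. -/
inductive Alternates (ρ : ℝ → ℝ) : ℕ → ℝ → Prop
  | nil : Alternates ρ 0 1
  | cons {n : ℕ} {r u s : ℝ} (hru : r ≤ u) (hus : u ≤ s) (anti : AntitoneOn ρ (Ioo r u))
      (mono : MonotoneOn ρ (Ioo u s)) (tail : Alternates ρ n s) : Alternates ρ (n + 1) r

theorem Alternates.le_one (h : Alternates ρ n r) : r ≤ 1 := by
  induction h with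
  | nil => exact le_rfl
  | cons hru hus _ _ _ ih => exact hru.trans (hus.trans ih)

theorem Alternates.exists_cappedClaim (h : Alternates (fun x => ψ x / φ x) n r) (hr : 0 ≤ r)
    (hH : IsSecurity H) (hφi : IntervalIntegrable φ volume 0 1)
    (hψi : IntervalIntegrable ψ volume 0 1) (hφ : ∀ x ∈ Ioo 0 1, 0 < φ x) :
    ∃ t c : Fin n → ℝ, (∀ i, t i ∈ Icc r 1) ∧ (∀ i, c i ∈ Icc (H r) 1) ∧
      ImprovesOn φ ψ r 1 (cappedClaim t c) H := by
  induction h with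
  | nil => exact ⟨Fin.elim0, Fin.elim0, (·.elim0), (·.elim0), improvesOn_self⟩
  | @cons n r u s hru hus hanti hmono htail ih =>
    have hr01 : r ∈ Icc (0 : ℝ) 1 := ⟨hr, hru.trans (hus.trans htail.le_one)⟩
    have hu01 : u ∈ Icc (0 : ℝ) 1 := ⟨hr.trans hru, hus.trans htail.le_one⟩
    have hs01 : s ∈ Icc (0 : ℝ) 1 := ⟨hu01.1.trans hus, htail.le_one⟩
    have hmem {x : ℝ} (hx : x ∈ Ioo u s) : x ∈ Icc (0 : ℝ) 1 :=
      ⟨hu01.1.trans hx.1.le, hx.2.le.trans hs01.2⟩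
    obtain ⟨t, c, ht, hc, htail_imp⟩ := ih hs01.1
    obtain ⟨c₀, hc₀, hcap_imp⟩ := hH.exists_standardDebt_improvesOn hφi hψi
      (fun x hx => hφ x ⟨hr.trans_lt hx.1, hx.2.trans_le hu01.2⟩) hr01 hu01 hru hanti
    have hc₀0 : 0 ≤ c₀ := (hH.nonneg r hr01).trans hc₀.1
    have hcc : ∀ i, c₀ ≤ c i := fun i => hc₀.2.trans ((hH.mono hu01 hs01 hus).trans (hc i).1)
    obtain ⟨v, hv, hswitch_imp⟩ := hH.exists_cappedClaim_switch hφi hψi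
      (fun x hx => hφ x ⟨hu01.1.trans_lt hx.1, hx.2.trans_le hs01.2⟩) hu01 hs01 hus hmono hc₀0 hcc
      (fun x hx => (min_le_right _ _).trans (hc₀.2.trans (hH.mono hu01 (hmem hx) hx.1.le)))
      (fun x hx => le_cappedClaim_iff.2 ⟨hH.le_self x (hmem hx),
        fun i (_ : x < t i) => (hH.mono (hmem hx) hs01 hx.2.le).trans (hc i).1⟩)
    have hK : IsSecurity (cappedClaim (Fin.cons v t : Fin (n + 1) → ℝ) (Fin.cons c₀ c)) :=
      isSecurity_cappedClaim (Fin.forall_fin_succ.2 ⟨hc₀0, fun i => hc₀0.trans (hcc i)⟩)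
    refine ⟨Fin.cons v t, Fin.cons c₀ c,
      Fin.forall_fin_succ.2 ⟨⟨hru.trans hv.1, hv.2.trans hs01.2⟩,
        fun i => ⟨(hru.trans hus).trans (ht i).1, (ht i).2⟩⟩,
      Fin.forall_fin_succ.2 ⟨⟨hc₀.1, hc₀.2.trans (hH.mem_Icc hu01).2⟩,
        fun i => ⟨hc₀.1.trans (hcc i), (hc i).2⟩⟩, ?_⟩
    refine (hcap_imp.congr_left hru fun x hx => ?_).add_adjacent (hswitch_imp.add_adjacent
      (htail_imp.congr_left hs01.2 fun x hx => ?_) hK hH hφi hψi hu01 hs01 ?_) hK hH hφi hψi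
      hr01 hu01 ?_
    · rw [cappedClaim_cons hcc, if_pos (hx.2.trans_le hv.1)]
    · rw [cappedClaim_cons hcc, if_neg (hv.2.trans_lt hx.1).not_gt]
    all_goals exact right_mem_Icc.2 zero_le_one

end Alternation

section Peaks

variable {κ : Type*} {ρ : ℝ → ℝ} {r : ℝ} {I : κ → Set ℝ} {T : Finset κ}

theorem lt_of_ordConnected_of_disjoint {α : Type*} [LinearOrder α] {s t : Set α} {x y p q : α}
    (hs : s.OrdConnected) (ht : t.OrdConnected) (hst : Disjoint s t) (hx : x ∈ s) (hy : y ∈ t)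
    (hxy : x < y) (hp : p ∈ s) (hq : q ∈ t) : p < q := by
  by_contra! hqp
  rcases le_total q x with hqx | hxq
  · exact disjoint_left.1 hst hx (ht.out hq hy ⟨hqx, hxy.le⟩)
  · exact disjoint_left.1 hst (hs.out hx hp ⟨hxq, hqp⟩) hq

theorem exists_forall_lt_of_pairwiseDisjoint (hT : T.Nonempty)
    (hconn : ∀ k ∈ T, (I k).OrdConnected) (hne : ∀ k ∈ T, (I k).Nonempty)
    (hdisj : (T : Set κ).PairwiseDisjoint I) :
    ∃ k ∈ T, ∀ j ∈ T, j ≠ k → ∀ x ∈ I k, ∀ y ∈ I j, x < y := by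
  choose! z hz using hne
  obtain ⟨k, hk, hmin⟩ := T.exists_min_image z hT
  refine ⟨k, hk, fun j hj hjk x hx y hy => ?_⟩
  have hdisj' : Disjoint (I k) (I j) := hdisj hk hj hjk.symm
  have hlt : z k < z j := (hmin j hj).lt_of_ne fun heq =>
    disjoint_left.1 hdisj' (hz k hk) (heq ▸ hz j hj)
  exact lt_of_ordConnected_of_disjoint (hconn k hk) (hconn j hj) hdisj' (hz k hk) (hz j hj)
    hlt hx hy

theorem notMem_iUnion_of_lt_csInf {k : κ} {x : ℝ} (hne : (I k).Nonempty) (hbelow : BddBelow (I k))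
    (hfirst : ∀ j ∈ T, j ≠ k → ∀ y ∈ I k, ∀ z ∈ I j, y < z) (hx : x < sInf (I k)) :
    x ∉ ⋃ j ∈ T, I j := by
  simp only [mem_iUnion, not_exists]
  intro j hj hxj
  rcases eq_or_ne j k with rfl | hjk
  · exact (csInf_le hbelow hxj).not_gt hx
  · obtain ⟨y, hy⟩ := hne
    exact ((csInf_le hbelow hy).trans (hfirst j hj hjk y hy x hxj).le).not_gt hx

theorem notMem_iUnion_of_csSup_lt [DecidableEq κ] {k : κ} {x : ℝ} (habove : BddAbove (I k))
    (hx : sSup (I k) < x) (hxT : x ∉ ⋃ j ∈ T.erase k, I j) : x ∉ ⋃ j ∈ T, I j := by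
  simp only [mem_iUnion, not_exists] at hxT ⊢
  intro j hj hxj
  rcases eq_or_ne j k with rfl | hjk
  · exact (le_csSup habove hxj).not_gt hx
  · exact hxT j (Finset.mem_erase.2 ⟨hjk, hj⟩) hxj

theorem alternates_of_antitoneOn_compl (hr : r ≤ 1) (hconn : ∀ k ∈ T, (I k).OrdConnected)
    (hne : ∀ k ∈ T, (I k).Nonempty) (hsub : ∀ k ∈ T, I k ⊆ Icc r 1)
    (hdisj : (T : Set κ).PairwiseDisjoint I) (hmono : ∀ k ∈ T, MonotoneOn ρ (I k))
    (hanti : ∀ p q, Ioo p q ⊆ Ioo r 1 \ ⋃ k ∈ T, I k → AntitoneOn ρ (Ioo p q)) :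
    Alternates ρ (T.card + 1) r ∧
      ∀ q ≤ r, MonotoneOn ρ (Ioo q r) → Alternates (fun x => -ρ x) (T.card + 1) q := by
  classical
  induction T using Finset.strongInduction generalizing r with | H T ih => ?_
  rcases T.eq_empty_or_nonempty with rfl | hT
  · have hr1 : AntitoneOn ρ (Ioo r 1) := hanti r 1 (by simp)
    exact ⟨.cons hr le_rfl hr1 (by rw [Ioo_self]; exact subsingleton_empty.monotoneOn ρ) .nil,
      fun q hq hqr => .cons hq hr hqr.neg hr1.neg .nil⟩
  obtain ⟨k, hk, hfirst⟩ := exists_forall_lt_of_pairwiseDisjoint hT hconn hne hdisj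
  have hbelow : BddBelow (I k) := bddBelow_Icc.mono (hsub k hk)
  have habove : BddAbove (I k) := bddAbove_Icc.mono (hsub k hk)
  set a := sInf (I k)
  set b := sSup (I k)
  have hra : r ≤ a := le_csInf (hne k hk) fun x hx => (hsub k hk hx).1
  have hab : a ≤ b := csInf_le_csSup (hne k hk) hbelow habove
  have hb1 : b ≤ 1 := csSup_le (hne k hk) fun x hx => (hsub k hk hx).2
  have hab_mono : MonotoneOn ρ (Ioo a b) := (hmono k hk).mono <|
    IsConnected.Ioo_csInf_csSup_subset ⟨hne k hk, (hconn k hk).isPreconnected⟩ hbelow habove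
  have hra_anti : AntitoneOn ρ (Ioo r a) := hanti r a fun x hx =>
    ⟨⟨hx.1, hx.2.trans_le (hab.trans hb1)⟩,
      notMem_iUnion_of_lt_csInf (hne k hk) hbelow hfirst hx.2⟩
  have herase : ∀ j ∈ T.erase k, j ∈ T := fun j => Finset.mem_of_mem_erase
  obtain ⟨htail, htail_neg⟩ := ih (T.erase k) (Finset.erase_ssubset hk) hb1
    (fun j hj => hconn j (herase j hj)) (fun j hj => hne j (herase j hj))
    (fun j hj y hy => ⟨csSup_le (hne k hk) fun x hx =>
      (hfirst j (herase j hj) (Finset.ne_of_mem_erase hj) x hx y hy).le,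
      (hsub j (herase j hj) hy).2⟩)
    (hdisj.subset (Finset.coe_subset.2 (T.erase_subset k))) (fun j hj => hmono j (herase j hj))
    fun p q hpq => hanti p q fun x hx =>
      ⟨⟨(hra.trans hab).trans_lt (hpq hx).1.1, (hpq hx).1.2⟩,
        notMem_iUnion_of_csSup_lt habove (hpq hx).1.1 (hpq hx).2⟩
  rw [← Finset.card_erase_add_one hk]
  exact ⟨.cons hra hab hra_anti hab_mono htail,
    fun q hq hqr => .cons hq hra hqr.neg hra_anti.neg (htail_neg a hab hab_mono)⟩

theorem IsPeaked.exists_alternates {n : ℕ} (h : IsPeaked n ρ) :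
    ∃ m ≤ n, Alternates ρ (m + 1) 0 ∧ Alternates (fun x => -ρ x) (m + 1) 0 := by
  classical
  obtain ⟨I, hconn, hsub, hdisj, hmono, hanti⟩ := h
  obtain ⟨halt, halt_neg⟩ := alternates_of_antitoneOn_compl (I := I) (ρ := ρ)
    (T := Finset.univ.filter fun k => (I k).Nonempty) zero_le_one (fun k _ => hconn k)
    (fun k hk => (Finset.mem_filter.1 hk).2) (fun k _ => hsub k) (hdisj.set_pairwise _)
    (fun k _ => hmono k) fun p q hpq => hanti _ ordConnected_Ioo fun x hx => by
      refine ⟨Ioo_subset_Icc_self (hpq hx).1, fun hxI => (hpq hx).2 ?_⟩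
      obtain ⟨k, hk⟩ := mem_iUnion.1 hxI
      exact mem_iUnion₂.2 ⟨k, Finset.mem_filter.2 ⟨Finset.mem_univ k, x, hk⟩, hk⟩
  exact ⟨_, (Finset.card_filter_le _ _).trans_eq (Finset.card_fin n), halt,
    halt_neg 0 le_rfl (by rw [Ioo_self]; exact subsingleton_empty.monotoneOn ρ)⟩

end Peaks

section Shift

theorem exists_eq_and_eq_of_fiberwise_eq {X Y : Type*} [TopologicalSpace X] [PreconnectedSpace X]
    [TopologicalSpace Y] [CompactSpace Y] {F G : X × Y → ℝ} {u v : ℝ} (hF : Continuous F)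
    (hG : Continuous G) (hfiber : ∀ x, ∃ y, F (x, y) = u)
    (hFG : ∀ x y z, F (x, y) = u → F (x, z) = u → G (x, y) = G (x, z))
    (hle : ∃ p, F p = u ∧ G p ≤ v) (hge : ∃ p, F p = u ∧ v ≤ G p) : ∃ p, F p = u ∧ G p = v := by
  have hlow : IsClosed (Prod.fst '' {p | F p = u ∧ G p ≤ v}) :=
    isClosedMap_fst_of_compactSpace _
      ((isClosed_eq hF continuous_const).inter (isClosed_le hG continuous_const))
  have hhigh : IsClosed (Prod.fst '' {p | F p = u ∧ v ≤ G p}) :=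
    isClosedMap_fst_of_compactSpace _
      ((isClosed_eq hF continuous_const).inter (isClosed_le continuous_const hG))
  have hcover :
      univ ⊆ Prod.fst '' {p | F p = u ∧ G p ≤ v} ∪ Prod.fst '' {p | F p = u ∧ v ≤ G p} := by
    intro x _
    obtain ⟨y, hy⟩ := hfiber x
    exact (le_total (G (x, y)) v).imp (fun h => ⟨(x, y), ⟨hy, h⟩, rfl⟩)
      fun h => ⟨(x, y), ⟨hy, h⟩, rfl⟩
  obtain ⟨p, hp⟩ := hle
  obtain ⟨q, hq⟩ := hge
  obtain ⟨x, -, ⟨⟨_, y⟩, ⟨hy, hGy⟩, rfl⟩, ⟨⟨_, z⟩, ⟨hz, hGz⟩, rfl⟩⟩ :=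
    isPreconnected_closed_iff.1 isPreconnected_univ _ _ hlow hhigh hcover
      ⟨p.1, mem_univ _, p, hp, rfl⟩ ⟨q.1, mem_univ _, q, hq, rfl⟩
  exact ⟨_, hy, hGy.antisymm (hGz.trans_eq (hFG _ _ _ hy hz).symm)⟩

variable {ι : Type*} [Fintype ι] {t c : ι → ℝ} {σ τ x : ℝ} {H w φ ψ : ℝ → ℝ}

/-- The capped claim whose caps `c` are raised by `σ`, within `[0, 1]`, and whose thresholds `t` are
lowered by `σ`. It increases in `σ`, so that `σ` can be used to adjust its mean. -/
noncomputable def shiftedClaim (t c : ι → ℝ) (σ : ℝ) : ℝ → ℝ :=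
  cappedClaim (fun i => t i - σ) fun i => max 0 (min 1 (c i + σ))

theorem isSecurity_shiftedClaim : IsSecurity (shiftedClaim t c σ) :=
  isSecurity_cappedClaim fun _ => le_max_left _ _

theorem shiftedClaim_mono (h : σ ≤ τ) : shiftedClaim t c σ x ≤ shiftedClaim t c τ x :=
  cappedClaim_mono_param (fun i => sub_le_sub_left h (t i))
    fun i => max_le_max_left 0 (min_le_min_left 1 (add_le_add_right h (c i)))

theorem shiftedClaim_zero (hc : ∀ i, c i ∈ Icc (0 : ℝ) 1) :
    shiftedClaim t c 0 = cappedClaim t c := by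
  simp only [shiftedClaim, sub_zero, add_zero, min_eq_right (hc _).2, max_eq_right (hc _).1]

theorem shiftedClaim_one (ht : ∀ i, t i ≤ 1) (hx : 0 ≤ x) : shiftedClaim t c 1 x = x :=
  cappedClaim_le_self.antisymm <| le_cappedClaim_iff.2
    ⟨le_rfl, fun i hi => absurd (hi.trans_le (sub_nonpos.2 (ht i))) hx.not_gt⟩

theorem shiftedClaim_neg_one [Nonempty ι] (ht : ∀ i, 0 ≤ t i) (hc : ∀ i, c i ≤ 1) (hx : x < 1) :
    shiftedClaim t c (-1) x ≤ 0 := by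
  obtain ⟨i⟩ := ‹Nonempty ι›
  refine (cappedClaim_le (i := i) (by linarith [ht i])).trans (max_le le_rfl ?_)
  exact (min_le_right _ _).trans (by linarith [hc i])

theorem continuous_integral_shiftedClaim_mul (hw : IntervalIntegrable w volume 0 1) :
    Continuous fun p : ((ι → ℝ) × (ι → ℝ)) × ℝ =>
      ∫ x in (0 : ℝ)..1, shiftedClaim p.1.1 p.1.2 p.2 x * w x :=
  (continuousOn_integral_cappedClaim_mul hw (left_mem_Icc.2 zero_le_one)
    (right_mem_Icc.2 zero_le_one)).comp_continuous
    (f := fun p : ((ι → ℝ) × (ι → ℝ)) × ℝ =>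
      ((fun i => p.1.1 i - p.2), fun i => max 0 (min 1 (p.1.2 i + p.2))))
    (by fun_prop) fun _ _ => le_max_left _ _

theorem IsSecurity.exists_shiftedClaim_integral_eq [Nonempty ι] (hH : IsSecurity H)
    (hφi : IntervalIntegrable φ volume 0 1) (hφ : ∀ x ∈ Ioo 0 1, 0 ≤ φ x)
    (ht : ∀ i, t i ∈ Icc (0 : ℝ) 1) (hc : ∀ i, c i ≤ 1) :
    ∃ σ ∈ Icc (-1 : ℝ) 1,
      ∫ x in (0 : ℝ)..1, shiftedClaim t c σ x * φ x = ∫ x in (0 : ℝ)..1, H x * φ x := by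
  have h0 : (0 : ℝ) ∈ Icc (0 : ℝ) 1 := left_mem_Icc.2 zero_le_one
  have h1 : (1 : ℝ) ∈ Icc (0 : ℝ) 1 := right_mem_Icc.2 zero_le_one
  have hcont : Continuous fun σ => ∫ x in (0 : ℝ)..1, shiftedClaim t c σ x * φ x :=
    (continuous_integral_shiftedClaim_mul hφi).comp (Continuous.prodMk_right (t, c))
  refine intermediate_value_Icc (by norm_num) hcont.continuousOn ⟨?_, ?_⟩
  · exact isSecurity_shiftedClaim.integral_mul_mono hH hφi hφ h0 h1 zero_le_one fun x hx =>
      (shiftedClaim_neg_one (fun i => (ht i).1) hc hx.2).trans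
        (hH.nonneg x (Ioo_subset_Icc_self hx))
  · refine hH.integral_mul_mono isSecurity_shiftedClaim hφi hφ h0 h1 zero_le_one fun x hx => ?_
    rw [shiftedClaim_one (fun i => (ht i).2) hx.1.le]
    exact hH.le_self x (Ioo_subset_Icc_self hx)

theorem integral_shiftedClaim_mul_eq (hφi : IntervalIntegrable φ volume 0 1)
    (hψi : IntervalIntegrable ψ volume 0 1) (hφ : ∀ x ∈ Ioo 0 1, 0 < φ x)
    (h : ∫ x in (0 : ℝ)..1, shiftedClaim t c σ x * φ x
      = ∫ x in (0 : ℝ)..1, shiftedClaim t c τ x * φ x) :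
    ∫ x in (0 : ℝ)..1, shiftedClaim t c σ x * ψ x
      = ∫ x in (0 : ℝ)..1, shiftedClaim t c τ x * ψ x := by
  have hint {σ : ℝ} {w : ℝ → ℝ} (hw : IntervalIntegrable w volume 0 1) :
      IntervalIntegrable (fun x => shiftedClaim t c σ x * w x) volume 0 1 :=
    isSecurity_shiftedClaim.intervalIntegrable_mul hw (left_mem_Icc.2 zero_le_one)
      (right_mem_Icc.2 zero_le_one)
  rcases le_total σ τ with hle | hle
  · exact integral_mul_eq_of_le zero_le_one hφ (fun _ _ => shiftedClaim_mono hle) (hint hφi)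
      (hint hφi) (hint hψi) (hint hψi) h
  · exact (integral_mul_eq_of_le zero_le_one hφ (fun _ _ => shiftedClaim_mono hle) (hint hφi)
      (hint hφi) (hint hψi) (hint hψi) h.symm).symm

theorem IsSecurity.exists_cappedClaim_integral_eq [Nonempty ι] (hH : IsSecurity H)
    (hφi : IntervalIntegrable φ volume 0 1) (hψi : IntervalIntegrable ψ volume 0 1)
    (hφ : ∀ x ∈ Ioo 0 1, 0 < φ x) {t₀ c₀ t₁ c₁ : ι → ℝ}
    (ht₀ : ∀ i, t₀ i ∈ Icc (0 : ℝ) 1) (hc₀ : ∀ i, c₀ i ∈ Icc (0 : ℝ) 1)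
    (ht₁ : ∀ i, t₁ i ∈ Icc (0 : ℝ) 1) (hc₁ : ∀ i, c₁ i ∈ Icc (0 : ℝ) 1)
    (hlow : ImprovesOn φ (fun x => -ψ x) 0 1 (cappedClaim t₀ c₀) H)
    (hhigh : ImprovesOn φ ψ 0 1 (cappedClaim t₁ c₁) H) :
    ∃ t c : ι → ℝ, (∀ i, c i ∈ Icc (0 : ℝ) 1) ∧
      (∫ x in (0 : ℝ)..1, cappedClaim t c x * φ x = ∫ x in (0 : ℝ)..1, H x * φ x) ∧
      ∫ x in (0 : ℝ)..1, cappedClaim t c x * ψ x = ∫ x in (0 : ℝ)..1, H x * ψ x := by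
  have hcont {w : ℝ → ℝ} (hw : IntervalIntegrable w volume 0 1) : Continuous fun
      p : ((ι → Icc (0 : ℝ) 1) × (ι → Icc (0 : ℝ) 1)) × Icc (-1 : ℝ) 1 =>
        ∫ x in (0 : ℝ)..1, shiftedClaim (fun i => p.1.1 i) (fun i => p.1.2 i) p.2 x * w x :=
    (continuous_integral_shiftedClaim_mul hw).comp (g := fun p => _)
      (f := fun p : ((ι → Icc (0 : ℝ) 1) × (ι → Icc (0 : ℝ) 1)) × Icc (-1 : ℝ) 1 =>
        (((fun i => (p.1.1 i : ℝ)), fun i => (p.1.2 i : ℝ)), (p.2 : ℝ))) (by fun_prop)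
  simp only [ImprovesOn, mul_neg, intervalIntegral.integral_neg, neg_le_neg_iff] at hlow
  obtain ⟨p, hpφ, hpψ⟩ := exists_eq_and_eq_of_fiberwise_eq (hcont hφi) (hcont hψi)
    (u := ∫ x in (0 : ℝ)..1, H x * φ x) (v := ∫ x in (0 : ℝ)..1, H x * ψ x)
    (fun p => by
      obtain ⟨σ, hσ, heq⟩ := hH.exists_shiftedClaim_integral_eq (t := fun i => p.1 i)
        (c := fun i => p.2 i) hφi (fun x hx => (hφ x hx).le) (fun i => (p.1 i).2)
        fun i => (p.2 i).2.2
      exact ⟨⟨σ, hσ⟩, heq⟩)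
    (fun p y z hy hz => integral_shiftedClaim_mul_eq hφi hψi hφ (hy.trans hz.symm))
    ⟨((fun i => ⟨t₀ i, ht₀ i⟩, fun i => ⟨c₀ i, hc₀ i⟩), ⟨0, by norm_num⟩), by
      simpa only [shiftedClaim_zero hc₀] using hlow⟩
    ⟨((fun i => ⟨t₁ i, ht₁ i⟩, fun i => ⟨c₁ i, hc₁ i⟩), ⟨0, by norm_num⟩), by
      simpa only [shiftedClaim_zero hc₁, ImprovesOn] using hhigh⟩
  exact ⟨_, _, fun i => ⟨le_max_left _ _, max_le zero_le_one (min_le_left _ _)⟩, hpφ, hpψ⟩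

end Shift

section Faces

/-- The profits in `[0,1]` at which `H` pays `d`. -/
def levelSet (H : ℝ → ℝ) (d : ℝ) : Set ℝ := {x ∈ Icc 0 1 | H x = d}

/-- The payments of `H` in `[0,1]` that are made out of a larger profit. For a contingent debt
contract these are the face values. -/
def faces (H : ℝ → ℝ) : Set ℝ := {d | ∃ x ∈ levelSet H d, d < x}

/-- The faces `d` of `H` that are not paid at the profit `d`: the security jumps or is already
constant there, and so a small change of `d` leaves a security. For a contingent debt contract
these include the non-defaultable face values. -/
def looseFaces (H : ℝ → ℝ) : Set ℝ := {d ∈ faces H | H d ≠ d}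

variable {H : ℝ → ℝ} {d : ℝ}

theorem looseFaces_subset_faces : looseFaces H ⊆ faces H := sep_subset _ _

theorem ordConnected_levelSet (hH : MonotoneOn H (Icc 0 1)) :
    (levelSet H d).OrdConnected where
  out' x hx y hy z hz := by
    have hzI : z ∈ Icc (0 : ℝ) 1 := ⟨hx.1.1.trans hz.1, hz.2.trans hy.1.2⟩
    exact ⟨hzI, ((hH hzI hy.1 hz.2).trans_eq hy.2).antisymm
      (hx.2.symm.trans_le (hH hx.1 hzI hz.1))⟩

theorem IsSecurity.mem_Ioo_of_mem_looseFaces (hH : IsSecurity H) (hd : d ∈ looseFaces H) :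
    d ∈ Ioo 0 1 := by
  obtain ⟨⟨x, ⟨hx, rfl⟩, hlt⟩, hne⟩ := hd
  refine ⟨(hH.nonneg x hx).lt_of_ne fun h0 => hne ?_, hlt.trans_le hx.2⟩
  rw [← h0]
  exact (hH.le_self 0 (left_mem_Icc.2 zero_le_one)).antisymm
    (hH.nonneg 0 (left_mem_Icc.2 zero_le_one))

theorem integral_add_mul_comp_mul {T : Finset ℝ} {β w : ℝ → ℝ} (hH : IsSecurity H)
    (hβ : ∀ d ∉ T, β d = 0) (hw : IntervalIntegrable w volume 0 1) (ε : ℝ) :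
    ∫ x in 0..1, (H x + ε * β (H x)) * w x = (∫ x in 0..1, H x * w x) +
      ε * ∑ d ∈ T, β d * ∫ x in 0..1, (levelSet H d).indicator w x := by
  have hpoint : EqOn (fun x => (H x + ε * β (H x)) * w x) (fun x => H x * w x +
      ε * ∑ d ∈ T, β d * (levelSet H d).indicator w x) (uIcc 0 1) := fun x hx => by
    rw [uIcc_of_le zero_le_one] at hx
    have hsum : ∑ d ∈ T, β d * (levelSet H d).indicator w x = β (H x) * w x := by
      rw [Finset.sum_eq_single (H x)]
      · rw [indicator_of_mem (show x ∈ levelSet H (H x) from ⟨hx, rfl⟩)]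
      · intro d _ hd
        rw [indicator_of_notMem (fun h : x ∈ levelSet H d => hd h.2.symm), mul_zero]
      · intro hT
        rw [hβ _ hT, zero_mul]
    simp only [hsum]
    ring
  have hind (d : ℝ) : IntervalIntegrable ((levelSet H d).indicator w) volume 0 1 := by
    rw [intervalIntegrable_iff] at hw ⊢
    exact hw.indicator (ordConnected_levelSet hH.mono).measurableSet
  have hHw : IntervalIntegrable (fun x => H x * w x) volume 0 1 :=
    hH.intervalIntegrable_mul hw (left_mem_Icc.2 zero_le_one) (right_mem_Icc.2 zero_le_one)
  have hsum : IntervalIntegrable (fun x => ∑ d ∈ T, β d * (levelSet H d).indicator w x)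
      volume 0 1 := by
    simpa only [Finset.sum_fn] using IntervalIntegrable.sum T fun d _ => (hind d).const_mul (β d)
  rw [intervalIntegral.integral_congr hpoint,
    intervalIntegral.integral_add hHw (hsum.const_mul ε), intervalIntegral.integral_const_mul,
    intervalIntegral.integral_finsetSum fun d _ => (hind d).const_mul (β d)]
  simp only [intervalIntegral.integral_const_mul]

variable {ι : Type*} [Fintype ι] {t q : ι → ℝ}

theorem faces_cappedClaim_subset_range : faces (cappedClaim t q) ⊆ range q := by
  rintro d ⟨x, hx, hlt⟩
  rcases cappedClaim_eq_self_or (t := t) (c := q) (x := x) with hself | ⟨i, -, hi⟩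
  · exact absurd (hx.2.symm.trans hself) hlt.ne
  · exact ⟨i, hi.symm.trans hx.2⟩

theorem finite_faces_cappedClaim : (faces (cappedClaim t q)).Finite :=
  (finite_range q).subset faces_cappedClaim_subset_range

theorem ncard_faces_cappedClaim_le : (faces (cappedClaim t q)).ncard ≤ Fintype.card ι := by
  rw [← Nat.card_eq_fintype_card]
  exact (ncard_le_ncard faces_cappedClaim_subset_range (finite_range q)).trans
    (Finite.card_range_le q)

theorem cappedClaim_comp {g : ℝ → ℝ} (hg : ∀ d ∉ looseFaces (cappedClaim t q), g d = d)
    (hgg : ∀ i j, q i < q j → g (q i) ≤ g (q j)) (hqg : ∀ i j, q i < q j → q i ≤ g (q j))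
    (hgt : ∀ i j, q i < t j → g (q i) ≤ t j) (x : ℝ) :
    cappedClaim t (fun i => g (q i)) x = g (cappedClaim t q x) := by
  have hloose (i : ι) (hi : q i ∈ looseFaces (cappedClaim t q)) :
      ∃ j, q i < t j ∧ cappedClaim t q (q i) = q j ∧ q j < q i := by
    obtain ⟨j, hj, hqj⟩ := (cappedClaim_eq_self_or (t := t) (c := q)).resolve_left hi.2
    exact ⟨j, hj, hqj, hqj ▸ cappedClaim_le_self.lt_of_ne hi.2⟩
  rcases (cappedClaim_le_self (t := t) (c := q) (x := x)).eq_or_lt with hx | hx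
  · rw [hx, hg x fun h => h.2 hx]
    refine cappedClaim_le_self.antisymm (le_cappedClaim_iff.2 ⟨le_rfl, fun i hi => ?_⟩)
    have hxq : x ≤ q i := hx.symm.trans_le (cappedClaim_le hi)
    by_cases hqi : q i ∈ looseFaces (cappedClaim t q)
    · obtain ⟨j, -, hj, hji⟩ := hloose i hqi
      calc x = cappedClaim t q x := hx.symm
        _ ≤ cappedClaim t q (q i) := monotone_cappedClaim hxq
        _ = q j := hj
        _ ≤ g (q i) := hqg j i hji
    · rwa [hg _ hqi]
  · obtain ⟨k, hk, hxk⟩ := cappedClaim_eq_self_or.resolve_left hx.ne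
    rw [hxk] at hx ⊢
    refine (cappedClaim_le hk).antisymm (le_cappedClaim_iff.2 ⟨?_, fun i hi => ?_⟩)
    · by_cases hqk : q k ∈ looseFaces (cappedClaim t q)
      · obtain ⟨j, hkj, -, hjk⟩ := hloose k hqk
        have hjx : t j ≤ x := by
          by_contra! hlt
          exact (hxk.symm.trans_le (cappedClaim_le hlt)).not_gt hjk
        exact (hgt k j hkj).trans hjx
      · exact (hg _ hqk).trans_le hx.le
    · rcases (hxk.symm.trans_le (cappedClaim_le hi)).eq_or_lt with heq | hlt
      · rw [heq]
      · exact hgg k i hlt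

theorem eventually_cappedClaim_add_mul_comp {β : ℝ → ℝ} (hq : ∀ i, q i ∈ Icc (0 : ℝ) 1)
    (hβ : ∀ d ∉ looseFaces (cappedClaim t q), β d = 0) :
    ∀ᶠ ε : ℝ in nhds 0, (∀ i, q i + ε * β (q i) ∈ Icc (0 : ℝ) 1) ∧
      cappedClaim t (fun i => q i + ε * β (q i))
        = fun x => cappedClaim t q x + ε * β (cappedClaim t q x) := by
  have hlt {a b : ℝ} (c d : ℝ) (hab : a < b) : ∀ᶠ ε : ℝ in nhds 0, a + ε * c < b + ε * d := by
    refine ContinuousAt.eventually_lt (by fun_prop) (by fun_prop) ?_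
    simpa only [zero_mul, add_zero] using hab
  have hmem : ∀ᶠ ε : ℝ in nhds 0, ∀ i, q i + ε * β (q i) ∈ Icc (0 : ℝ) 1 := by
    refine Filter.eventually_all.2 fun i => ?_
    by_cases hi : q i ∈ looseFaces (cappedClaim t q)
    · have hi01 := (isSecurity_cappedClaim fun i => (hq i).1).mem_Ioo_of_mem_looseFaces hi
      filter_upwards [hlt 0 (β (q i)) hi01.1, hlt (β (q i)) 0 hi01.2] with ε h0 h1
      constructor <;> linarith
    · simpa only [hβ _ hi, mul_zero, add_zero] using Filter.Eventually.of_forall fun _ => hq i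
  have hgg : ∀ᶠ ε : ℝ in nhds 0, ∀ i j, q i < q j → q i + ε * β (q i) < q j + ε * β (q j) :=
    Filter.eventually_all.2 fun i => Filter.eventually_all.2 fun j =>
      Filter.eventually_imp_distrib_left.2 (hlt _ _)
  have hqg : ∀ᶠ ε : ℝ in nhds 0, ∀ i j, q i < q j → q i + ε * 0 < q j + ε * β (q j) :=
    Filter.eventually_all.2 fun i => Filter.eventually_all.2 fun j =>
      Filter.eventually_imp_distrib_left.2 (hlt _ _)
  have hgt : ∀ᶠ ε : ℝ in nhds 0, ∀ i j, q i < t j → q i + ε * β (q i) < t j + ε * 0 :=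
    Filter.eventually_all.2 fun i => Filter.eventually_all.2 fun j =>
      Filter.eventually_imp_distrib_left.2 (hlt _ _)
  filter_upwards [hmem, hgg, hqg, hgt] with ε hmem hgg hqg hgt
  simp only [mul_zero, add_zero] at hqg hgt
  refine ⟨hmem, funext fun x => cappedClaim_comp (g := fun d => d + ε * β d) (fun d hd => ?_)
    (fun i j h => (hgg i j h).le) (fun i j h => (hqg i j h).le) (fun i j h => (hgt i j h).le) x⟩
  rw [hβ d hd, mul_zero, add_zero]

theorem exists_cappedClaim_forall_sum_sq_le {κ : Type*} {w : κ → ℝ → ℝ}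
    (hw : ∀ k, IntervalIntegrable (w k) volume 0 1) {c : ι → ℝ} (hc : ∀ i, c i ∈ Icc (0 : ℝ) 1) :
    ∃ q : ι → ℝ, (∀ i, q i ∈ Icc (0 : ℝ) 1) ∧
      (∀ k, ∫ x in 0..1, cappedClaim t q x * w k x = ∫ x in 0..1, cappedClaim t c x * w k x) ∧
      ∀ q' : ι → ℝ, (∀ i, q' i ∈ Icc (0 : ℝ) 1) →
        (∀ k, ∫ x in 0..1, cappedClaim t q' x * w k x
          = ∫ x in 0..1, cappedClaim t c x * w k x) →
        ∑ i, q' i ^ 2 ≤ ∑ i, q i ^ 2 := by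
  set F : (ι → ℝ) → κ → ℝ := fun q k => ∫ x in 0..1, cappedClaim t q x * w k x
  have hF : ContinuousOn F (Icc 0 1) := continuousOn_pi.2 fun k =>
    (continuousOn_integral_cappedClaim_mul (hw k) (left_mem_Icc.2 zero_le_one)
      (right_mem_Icc.2 zero_le_one)).comp (f := fun q => (t, q)) (by fun_prop)
      fun q hq i => hq.1 i
  have hmem (q : ι → ℝ) : q ∈ Icc 0 1 ∩ F ⁻¹' {F c} ↔
      (∀ i, q i ∈ Icc (0 : ℝ) 1) ∧ ∀ k, F q k = F c k :=
    and_congr ⟨fun h i => ⟨h.1 i, h.2 i⟩, fun h => ⟨fun i => (h i).1, fun i => (h i).2⟩⟩ funext_iff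
  have hcompact : IsCompact (Icc 0 1 ∩ F ⁻¹' {F c}) := isCompact_Icc.of_isClosed_subset
    (hF.preimage_isClosed_of_isClosed isClosed_Icc isClosed_singleton) inter_subset_left
  obtain ⟨q, hq, hmax⟩ := hcompact.exists_isMaxOn ⟨c, (hmem c).2 ⟨hc, fun _ => rfl⟩⟩
    (f := fun q : ι → ℝ => ∑ i, q i ^ 2) (by fun_prop)
  exact ⟨q, ((hmem q).1 hq).1, ((hmem q).1 hq).2,
    fun q' hq' hqc => hmax ((hmem q').2 ⟨hq', hqc⟩)⟩

theorem exists_sum_mul_eq_zero_of_card_lt {α κ : Type*} [Fintype κ] {T : Finset α}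
    (hT : Fintype.card κ < T.card) (A : α → κ → ℝ) :
    ∃ β : α → ℝ, (∀ a ∉ T, β a = 0) ∧ (∃ a ∈ T, β a ≠ 0) ∧ ∀ k, ∑ a ∈ T, β a * A a k = 0 := by
  have hdep : ¬ LinearIndepOn ℝ A (T : Set α) := fun h =>
    hT.not_ge (by simpa using h.fintype_card_le_finrank)
  obtain ⟨f, hf, a, ha, hfa⟩ := not_linearIndepOn_finset_iff.1 hdep
  refine ⟨(T : Set α).indicator f, fun a ha => indicator_of_notMem (by exact_mod_cast ha) f,
    ⟨a, ha, by rwa [indicator_of_mem (Finset.mem_coe.2 ha)]⟩, fun k => ?_⟩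
  calc ∑ a ∈ T, (T : Set α).indicator f a * A a k
      = ∑ a ∈ T, f a * A a k := Finset.sum_congr rfl fun a ha => by
        rw [indicator_of_mem (Finset.mem_coe.2 ha)]
    _ = 0 := by
      simpa only [Finset.sum_apply, Pi.smul_apply, smul_eq_mul, Pi.zero_apply] using congrFun hf k

theorem not_eventually_sum_sq_add_mul_le {x v : ι → ℝ} (hv : v ≠ 0) :
    ¬ ∀ᶠ ε : ℝ in nhds 0, ∑ i, (x i + ε * v i) ^ 2 ≤ ∑ i, x i ^ 2 := by
  intro h
  have hneg : ∀ᶠ ε : ℝ in nhds 0, ∑ i, (x i + -ε * v i) ^ 2 ≤ ∑ i, x i ^ 2 := by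
    refine (continuous_neg.tendsto' (0 : ℝ) 0 neg_zero).eventually h
  obtain ⟨ε, ⟨hle, hle'⟩, hε⟩ := ((h.and hneg).filter_mono nhdsWithin_le_nhds |>.and
    (self_mem_nhdsWithin (s := Ioi (0 : ℝ)))).exists
  have hsum : ∑ i, (x i + ε * v i) ^ 2 + ∑ i, (x i + -ε * v i) ^ 2
      = 2 * ∑ i, x i ^ 2 + 2 * ε ^ 2 * ∑ i, v i ^ 2 := by
    simp only [Finset.mul_sum, ← Finset.sum_add_distrib]
    exact Finset.sum_congr rfl fun i _ => by ring
  obtain ⟨i, hi⟩ := Function.ne_iff.1 hv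
  have hpos : 0 < ∑ i, v i ^ 2 :=
    Finset.sum_pos' (fun i _ => sq_nonneg _) ⟨i, Finset.mem_univ i, sq_pos_of_ne_zero hi⟩
  have hε2 : 0 < ε ^ 2 := pow_pos hε 2
  nlinarith [mul_pos hε2 hpos]

theorem exists_cappedClaim_ncard_looseFaces_le {κ : Type*} [Fintype κ] {w : κ → ℝ → ℝ}
    (hw : ∀ k, IntervalIntegrable (w k) volume 0 1) {c : ι → ℝ} (hc : ∀ i, c i ∈ Icc (0 : ℝ) 1) :
    ∃ q : ι → ℝ, (∀ i, q i ∈ Icc (0 : ℝ) 1) ∧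
      (∀ k, ∫ x in 0..1, cappedClaim t q x * w k x = ∫ x in 0..1, cappedClaim t c x * w k x) ∧
      (looseFaces (cappedClaim t q)).ncard ≤ Fintype.card κ := by
  obtain ⟨q, hq, hqc, hmax⟩ := exists_cappedClaim_forall_sum_sq_le (t := t) hw hc
  refine ⟨q, hq, hqc, ?_⟩
  by_contra! hcard
  obtain ⟨T, hT⟩ := ((finite_faces_cappedClaim (t := t) (q := q)).subset
    looseFaces_subset_faces).exists_finset_coe
  rw [← hT, ncard_coe_finset] at hcard
  obtain ⟨β, hβT, ⟨d, hd, hβd⟩, hβ⟩ := exists_sum_mul_eq_zero_of_card_lt hcard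
    fun d k => ∫ x in 0..1, (levelSet (cappedClaim t q) d).indicator (w k) x
  have hdloose : d ∈ looseFaces (cappedClaim t q) := hT ▸ Finset.mem_coe.2 hd
  obtain ⟨i, rfl⟩ := faces_cappedClaim_subset_range hdloose.1
  refine not_eventually_sum_sq_add_mul_le (x := q) (v := fun i => β (q i))
    (Function.ne_iff.2 ⟨i, hβd⟩) ?_
  filter_upwards [eventually_cappedClaim_add_mul_comp hq
    fun d hd => hβT d (by rwa [← Finset.mem_coe, hT])] with ε hε
  refine hmax _ hε.1 fun k => ?_
  rw [hε.2, integral_add_mul_comp_mul (isSecurity_cappedClaim fun i => (hq i).1) hβT (hw k),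
    hβ k, mul_zero, add_zero, hqc k]

end Faces

section ContingentDebt

variable {H : ℝ → ℝ} {d y : ℝ}

theorem IsSecurity.csInf_mem_levelSet (hH : IsSecurity H) (hne : (levelSet H d).Nonempty) :
    sInf (levelSet H d) ∈ levelSet H d := by
  set l := sInf (levelSet H d)
  have hbdd : BddBelow (levelSet H d) := ⟨0, fun y hy => hy.1.1⟩
  have hl (y : ℝ) (hy : y ∈ levelSet H d) : l ≤ y := csInf_le hbdd hy
  obtain ⟨x, hx⟩ := hne
  have hl0 : 0 ≤ l := le_csInf ⟨x, hx⟩ fun y hy => hy.1.1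
  rcases ((hl x hx).trans hx.1.2).eq_or_lt with hl1 | hl1
  · rwa [show l = x from (hl x hx).antisymm (hx.1.2.trans_eq hl1.symm)]
  · have : (nhdsWithin l (levelSet H d)).NeBot :=
      (isGLB_csInf ⟨x, hx⟩ hbdd).nhdsWithin_neBot ⟨x, hx⟩
    have hlim : Filter.Tendsto H (nhdsWithin l (levelSet H d)) (nhds d) :=
      tendsto_const_nhds.congr' (by
        filter_upwards [self_mem_nhdsWithin] with y hy using hy.2.symm)
    exact ⟨⟨hl0, hl1.le⟩, tendsto_nhds_unique ((hH.rightCont l ⟨hl0, hl1⟩).mono hl) hlim⟩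

theorem IsSecurity.levelSet_mem_nhdsGE (hH : IsSecurity H) (hfin : (faces H).Finite)
    (hy : y ∈ levelSet H d) (hdy : d < y) (hy1 : y < 1) : levelSet H d ∈ nhdsWithin y (Ici y) := by
  have hcont := hH.rightCont y ⟨hy.1.1, hy1⟩
  rw [ContinuousWithinAt, hy.2] at hcont
  have hisolated : ∀ᶠ e in nhds d, e ∉ faces H \ {d} :=
    (hfin.subset sdiff_subset).isClosed.isOpen_compl.mem_nhds fun h => h.2 rfl
  filter_upwards [hcont.eventually hisolated, hcont.eventually (gt_mem_nhds hdy),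
    self_mem_nhdsWithin, nhdsWithin_le_nhds (Iio_mem_nhds hy1)] with z hz hzy hyz hz1
  have hzI : z ∈ Icc (0 : ℝ) 1 := ⟨hy.1.1.trans hyz, hz1.le⟩
  by_contra hne
  exact hz ⟨⟨z, ⟨hzI, rfl⟩, hzy.trans_le hyz⟩, fun h => hne ⟨hzI, h⟩⟩

theorem IsSecurity.exists_forall_mem_Ico_iff_mem_levelSet (hH : IsSecurity H)
    (hfin : (faces H).Finite) (hd : d ∈ faces H) :
    ∃ u, ∀ x ∈ Icc (0 : ℝ) 1, x ∈ Ico (sInf (levelSet H d)) u ↔ x ∈ levelSet H d := by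
  obtain ⟨x₀, hx₀, hdx₀⟩ := hd
  have hbdd : BddBelow (levelSet H d) := ⟨0, fun y hy => hy.1.1⟩
  have hbdd' : BddAbove (levelSet H d) := ⟨1, fun y hy => hy.1.2⟩
  have hord := ordConnected_levelSet hH.mono (d := d)
  have hinf := hH.csInf_mem_levelSet ⟨x₀, hx₀⟩
  by_cases hsup : sSup (levelSet H d) ∈ levelSet H d
  · have hsup1 : sSup (levelSet H d) = 1 := by
      refine hsup.1.2.eq_of_not_lt fun hlt => ?_
      obtain ⟨z, hz, hsub⟩ := mem_nhdsGE_iff_exists_Ico_subset.1 (hH.levelSet_mem_nhdsGE hfin hsup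
        (hdx₀.trans_le (le_csSup hbdd' hx₀)) hlt)
      obtain ⟨y, hy, hyz⟩ := exists_between (mem_Ioi.1 hz)
      exact (le_csSup hbdd' (hsub ⟨hy.le, hyz⟩)).not_gt hy
    refine ⟨2, fun x hx => ⟨fun h => hord.out hinf hsup ⟨h.1, hx.2.trans_eq hsup1.symm⟩,
      fun h => ⟨csInf_le hbdd h, hx.2.trans_lt one_lt_two⟩⟩⟩
  · refine ⟨sSup (levelSet H d), fun x _ => ⟨fun h => ?_, fun h => ⟨csInf_le hbdd h, ?_⟩⟩⟩
    · obtain ⟨y, hy, hxy⟩ := exists_lt_of_lt_csSup ⟨x₀, hx₀⟩ h.2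
      exact hord.out hinf hy ⟨h.1, hxy.le⟩
    · exact (le_csSup hbdd' h).lt_of_ne fun heq => hsup (heq ▸ h)

theorem IsSecurity.exists_isContingentDebt (hH : IsSecurity H) (hfin : (faces H).Finite) :
    ∃ lo hi : Fin (faces H).ncard → ℝ, IsContingentDebt H lo hi ∧
      {n | NonDefaultable H lo hi n}.ncard ≤ (looseFaces H).ncard := by
  obtain ⟨e⟩ : Nonempty (Fin (faces H).ncard ≃ faces H) := by
    have := hfin.to_subtype
    exact ⟨(Finite.equivFinOfCardEq (Nat.card_coe_set_eq (faces H))).symm⟩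
  have hne (n) : (levelSet H (e n)).Nonempty := (e n).2.imp fun _ => And.left
  choose hi hIco using fun n => hH.exists_forall_mem_Ico_iff_mem_levelSet hfin (e n).2
  set lo := fun n => sInf (levelSet H (e n))
  have hlo (n) : lo n ∈ levelSet H (e n) := hH.csInf_mem_levelSet (hne n)
  refine ⟨lo, hi, ⟨hH, fun n => (hlo n).1, fun n => ((hIco n _ (hlo n).1).2 (hlo n)).2,
    fun n x hx => ?_, fun x hx hout => ?_, fun m n hmn => ?_⟩, ?_⟩
  · exact ((hIco n x hx.2).1 hx.1).2.trans (hlo n).2.symm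
  · by_contra hne
    obtain ⟨n, hn⟩ := e.surjective ⟨H x, x, ⟨hx, rfl⟩, (hH.le_self x hx).lt_of_ne hne⟩
    exact hout n ((hIco n x hx).2 ⟨hx, (congrArg Subtype.val hn).symm⟩)
  · exact e.injective (Subtype.ext ((hlo m).2.symm.trans (hmn.trans (hlo n).2)))
  · refine ncard_le_ncard_of_injOn (fun n => (e n : ℝ)) (fun n hn => ⟨(e n).2, fun heq => ?_⟩)
      (Subtype.val_injective.comp e.injective).injOn (hfin.subset looseFaces_subset_faces)
    obtain ⟨x, ⟨hx, hxd⟩, hdx⟩ := (e n).2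
    have hmem : (e n : ℝ) ∈ Icc (0 : ℝ) 1 := ⟨hxd ▸ hH.nonneg x hx, hdx.le.trans hx.2⟩
    have hlt := hn _ ⟨(hIco n _ hmem).2 ⟨hmem, heq⟩, hmem⟩
    exact ((hlo n).2.symm.trans_lt hlt).false

theorem IsSecurity.exists_isContingentDebt_integral_eq {φ ψ : ℝ → ℝ} {n : ℕ} (hH : IsSecurity H)
    (hφi : IntervalIntegrable φ volume 0 1) (hψi : IntervalIntegrable ψ volume 0 1)
    (hφ : ∀ x ∈ Ioo 0 1, 0 < φ x) (hn : IsPeaked n fun x => ψ x / φ x) :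
    ∃ K : ℝ → ℝ, (∃ k ≤ n + 1, ∃ lo hi : Fin k → ℝ,
        IsContingentDebt K lo hi ∧ {i | NonDefaultable K lo hi i}.ncard ≤ 2) ∧
      (∫ x in (0 : ℝ)..1, K x * φ x = ∫ x in (0 : ℝ)..1, H x * φ x) ∧
      ∫ x in (0 : ℝ)..1, K x * ψ x = ∫ x in (0 : ℝ)..1, H x * ψ x := by
  obtain ⟨m, hm, hρ, hnegρ⟩ := hn.exists_alternates
  simp only [← neg_div] at hnegρ
  obtain ⟨t₀, c₀, ht₀, hc₀, hlow⟩ := hnegρ.exists_cappedClaim le_rfl hH hφi hψi.neg hφ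
  obtain ⟨t₁, c₁, ht₁, hc₁, hhigh⟩ := hρ.exists_cappedClaim le_rfl hH hφi hψi hφ
  have hcaps : Icc (H 0) 1 ⊆ Icc 0 1 := Icc_subset_Icc_left (hH.nonneg 0 (by simp))
  obtain ⟨t, c, hc, hcφ, hcψ⟩ := hH.exists_cappedClaim_integral_eq hφi hψi hφ ht₀
    (fun i => hcaps (hc₀ i)) ht₁ (fun i => hcaps (hc₁ i)) hlow hhigh
  have hw : ∀ k : Fin 2, IntervalIntegrable (![φ, ψ] k) volume 0 1 :=
    Fin.forall_fin_two.2 ⟨hφi, hψi⟩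
  obtain ⟨q, hq, hqw, hloose⟩ := exists_cappedClaim_ncard_looseFaces_le (t := t) hw hc
  obtain ⟨lo, hi, hdebt, hnd⟩ :=
    (isSecurity_cappedClaim fun i => (hq i).1).exists_isContingentDebt finite_faces_cappedClaim
  refine ⟨cappedClaim t q, ⟨_, ncard_faces_cappedClaim_le.trans ?_, lo, hi, hdebt, hnd.trans ?_⟩,
    (hqw 0).trans hcφ, (hqw 1).trans hcψ⟩
  · rw [Fintype.card_fin]
    lia
  · rwa [Fintype.card_fin] at hloose

end ContingentDebt

theorem aestronglyMeasurable_of_hasDerivWithinAt {α : Type*} [MeasurableSpace α] {μ : Measure α}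
    {F : ℝ → α → ℝ} {F' : α → ℝ} {s : Set ℝ} {e : ℝ} (hs : UniqueDiffWithinAt ℝ s e) (he : e ∈ s)
    (hF : ∀ t ∈ s, AEStronglyMeasurable (F t) μ)
    (hF' : ∀ᵐ x ∂μ, HasDerivWithinAt (fun t => F t x) (F' x) s e) :
    AEStronglyMeasurable F' μ := by
  have hclosure : e ∈ closure (s \ {e}) :=
    mem_closure_iff_nhdsWithin_neBot.2 (accPt_principal_iff_nhdsWithin.1 hs.accPt)
  obtain ⟨u, hu, hlim⟩ := mem_closure_iff_seq_limit.1 hclosure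
  refine aestronglyMeasurable_of_tendsto_ae Filter.atTop
    (f := fun n x => slope (fun t => F t x) e (u n)) (fun n => ?_) ?_
  · simp only [slope_def_module, smul_eq_mul]
    exact ((hF _ (hu n).1).sub (hF e he)).const_mul _
  · filter_upwards [hF'] with x hx
    exact (hasDerivWithinAt_iff_tendsto_slope.1 hx).comp
      (tendsto_nhdsWithin_iff.2 ⟨hlim, Filter.Eventually.of_forall hu⟩)

namespace Model

variable {M : Model} {e t x d : ℝ} {D H K f : ℝ → ℝ}

theorem intervalIntegrable_density (he : e ∈ Icc 0 M.maxEffort) :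
    IntervalIntegrable (fun x => M.density x e) volume 0 1 :=
  (intervalIntegrable_iff_integrableOn_Icc_of_le zero_le_one).2 (M.density_integrable e he)

theorem intervalIntegrable_densityDeriv (he : e ∈ Icc 0 M.maxEffort) :
    IntervalIntegrable (fun x => M.densityDeriv x e) volume 0 1 := by
  obtain ⟨g, hg, hbound⟩ := M.densityDeriv_dominated
  refine (intervalIntegrable_iff_integrableOn_Icc_of_le zero_le_one).2 (hg.mono' ?_ ?_)
  · exact aestronglyMeasurable_of_hasDerivWithinAt (F := fun t x => M.density x t)
      (uniqueDiffOn_Icc M.maxEffort_pos e he) he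
      (fun t ht => (M.density_integrable t ht).aestronglyMeasurable)
      (ae_restrict_of_forall_mem measurableSet_Icc fun x hx => M.density_hasDeriv x hx e he)
  · exact ae_restrict_of_forall_mem measurableSet_Icc fun x hx => hbound x hx e he

theorem intervalIntegrable_mul_density (hf : MonotoneOn f (Icc 0 1))
    (he : e ∈ Icc 0 M.maxEffort) :
    IntervalIntegrable (fun x => f x * M.density x e) volume 0 1 :=
  intervalIntegrable_mul_of_monotoneOn (by rwa [uIcc_of_le (zero_le_one' ℝ)])
    (intervalIntegrable_density he)

theorem intervalIntegrable_mul_densityDeriv (hf : MonotoneOn f (Icc 0 1))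
    (he : e ∈ Icc 0 M.maxEffort) :
    IntervalIntegrable (fun x => f x * M.densityDeriv x e) volume 0 1 :=
  intervalIntegrable_mul_of_monotoneOn (by rwa [uIcc_of_le (zero_le_one' ℝ)])
    (intervalIntegrable_densityDeriv he)

theorem abs_density_sub_le {g : ℝ → ℝ}
    (hg : ∀ x ∈ Icc (0 : ℝ) 1, ∀ e ∈ Icc 0 M.maxEffort, |M.densityDeriv x e| ≤ g x)
    (hx : x ∈ Icc (0 : ℝ) 1) (he : e ∈ Icc 0 M.maxEffort) (ht : t ∈ Icc 0 M.maxEffort) :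
    |M.density x t - M.density x e| ≤ g x * M.maxEffort :=
  calc |M.density x t - M.density x e| ≤ g x * |t - e| :=
        (convex_Icc 0 M.maxEffort).norm_image_sub_le_of_norm_hasDerivWithin_le
          (M.density_hasDeriv x hx) (hg x hx) he ht
    _ ≤ g x * M.maxEffort := by
        have hdist : |t - e| ≤ M.maxEffort := by
          simpa only [Real.dist_eq, sub_zero] using Real.dist_le_of_mem_Icc ht he
        exact mul_le_mul_of_nonneg_left hdist ((abs_nonneg _).trans (hg x hx e he))

theorem continuousOn_integral_mul_density (hf : MonotoneOn f (Icc 0 1)) :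
    ContinuousOn (fun e => ∫ x in (0 : ℝ)..1, f x * M.density x e) (Icc 0 M.maxEffort) := by
  obtain ⟨g, hg, hbound⟩ := M.densityDeriv_dominated
  have hg01 := (intervalIntegrable_iff_integrableOn_Icc_of_le zero_le_one).2 hg
  have hmem {x : ℝ} (hx : x ∈ uIoc 0 1) : x ∈ Icc (0 : ℝ) 1 :=
    Ioc_subset_Icc_self (by rwa [uIoc_of_le zero_le_one] at hx)
  intro e he
  refine intervalIntegral.continuousWithinAt_of_dominated_interval
    (bound := fun x => max |f 0| |f 1| * (|M.density x e| + g x * M.maxEffort)) ?_ ?_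
    (((intervalIntegrable_density he).abs.add (hg01.mul_const _)).const_mul _) ?_
  · filter_upwards [self_mem_nhdsWithin] with t ht
    exact (intervalIntegrable_iff.1 (intervalIntegrable_mul_density hf ht)).aestronglyMeasurable
  · filter_upwards [self_mem_nhdsWithin] with t ht
    refine Filter.Eventually.of_forall fun x hx => ?_
    rw [norm_mul, Real.norm_eq_abs, Real.norm_eq_abs]
    have hlip := abs_density_sub_le hbound (hmem hx) he ht
    have htri := abs_sub_abs_le_abs_sub (M.density x t) (M.density x e)
    exact mul_le_mul (abs_le_max_abs_of_monotoneOn hf (hmem hx)) (by linarith) (abs_nonneg _)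
      (le_max_of_le_left (abs_nonneg _))
  · exact Filter.Eventually.of_forall fun x hx =>
      continuousWithinAt_const.mul (M.density_hasDeriv x (hmem hx) e he).continuousWithinAt

theorem hasDerivAt_integral_mul_density (hf : MonotoneOn f (Icc 0 1))
    (he : e ∈ Ioo 0 M.maxEffort) :
    HasDerivAt (fun t => ∫ x in (0 : ℝ)..1, f x * M.density x t)
      (∫ x in (0 : ℝ)..1, f x * M.densityDeriv x e) e := by
  obtain ⟨g, hg, hbound⟩ := M.densityDeriv_dominated
  have hg01 := (intervalIntegrable_iff_integrableOn_Icc_of_le zero_le_one).2 hg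
  have hmem {x : ℝ} (hx : x ∈ uIoc 0 1) : x ∈ Icc (0 : ℝ) 1 :=
    Ioc_subset_Icc_self (by rwa [uIoc_of_le zero_le_one] at hx)
  have hnhds : Ioo 0 M.maxEffort ∈ nhds e := Ioo_mem_nhds he.1 he.2
  have heI := Ioo_subset_Icc_self he
  refine (intervalIntegral.hasDerivAt_integral_of_dominated_loc_of_deriv_le
    (bound := fun x => max |f 0| |f 1| * g x) (F := fun t x => f x * M.density x t)
    (F' := fun t x => f x * M.densityDeriv x t) hnhds ?_
    (intervalIntegrable_mul_density hf heI)
    (intervalIntegrable_iff.1 (intervalIntegrable_mul_densityDeriv hf heI)).aestronglyMeasurable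
    ?_ (hg01.const_mul _) ?_).2
  · filter_upwards [hnhds] with t ht
    exact (intervalIntegrable_iff.1
      (intervalIntegrable_mul_density hf (Ioo_subset_Icc_self ht))).aestronglyMeasurable
  · refine Filter.Eventually.of_forall fun x hx t ht => ?_
    rw [norm_mul, Real.norm_eq_abs, Real.norm_eq_abs]
    exact mul_le_mul (abs_le_max_abs_of_monotoneOn hf (hmem hx))
      (hbound x (hmem hx) t (Ioo_subset_Icc_self ht)) (abs_nonneg _)
      (le_max_of_le_left (abs_nonneg _))
  · exact Filter.Eventually.of_forall fun x hx t ht =>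
      ((M.density_hasDeriv x (hmem hx) t (Ioo_subset_Icc_self ht)).hasDerivAt
        (Icc_mem_nhds ht.1 ht.2)).const_mul _

theorem integral_densityDeriv_eq_zero (he : e ∈ Ioo 0 M.maxEffort) :
    ∫ x in (0 : ℝ)..1, M.densityDeriv x e = 0 := by
  have hderiv := hasDerivAt_integral_mul_density (f := fun _ => 1) monotoneOn_const he
  simp only [one_mul] at hderiv
  refine hderiv.unique ((hasDerivAt_const e (1 : ℝ)).congr_of_eventuallyEq ?_)
  filter_upwards [Ioo_mem_nhds he.1 he.2] with t ht
  exact M.density_integral t (Ioo_subset_Icc_self ht)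

theorem hasDerivAt_investorReturn (hH : IsSecurity H) (he : e ∈ Ioo 0 M.maxEffort) :
    HasDerivAt (M.investorReturn H) (∫ x in (0 : ℝ)..1, H x * M.densityDeriv x e) e :=
  hasDerivAt_integral_mul_density hH.mono he

theorem continuousOn_investorReturn (hH : IsSecurity H) :
    ContinuousOn (M.investorReturn H) (Icc 0 M.maxEffort) :=
  continuousOn_integral_mul_density hH.mono

theorem requiredReturn_pos : 0 < M.requiredReturn :=
  mul_pos (add_pos one_pos M.rate_pos) M.investment_pos

variable (M) in
/-- The joint expected payoff of entrepreneur and investor. It does not depend on the security, so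
the entrepreneur's problem amounts to maximizing it while paying out no more than required. -/
noncomputable def surplus (e : ℝ) : ℝ := M.investorReturn (fun x => x) e - M.cost e

variable (M) in
/-- At every effort, some security satisfies the first-order condition and returns exactly what
the investor requires. -/
def RequiredReturnAttainable : Prop :=
  ∀ e ∈ Icc 0 M.maxEffort,
    ∃ H, IsSecurity H ∧ M.FirstOrder H e ∧ M.investorReturn H e = M.requiredReturn

theorem continuousOn_surplus : ContinuousOn M.surplus (Icc 0 M.maxEffort) :=
  (continuousOn_investorReturn isSecurity_id).sub fun e he =>
    (M.cost_hasDeriv e he).continuousWithinAt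

theorem integral_retained_mul {w : ℝ → ℝ} (hH : IsSecurity H)
    (hw : IntervalIntegrable w volume 0 1) :
    ∫ x in (0 : ℝ)..1, (x - H x) * w x
      = (∫ x in (0 : ℝ)..1, x * w x) - ∫ x in (0 : ℝ)..1, H x * w x :=
  isSecurity_id.integral_sub_mul hH hw (left_mem_Icc.2 zero_le_one) (right_mem_Icc.2 zero_le_one)

theorem payoff_eq_surplus_sub (hH : IsSecurity H) (he : e ∈ Icc 0 M.maxEffort) :
    M.payoff H e = M.surplus e - M.investorReturn H e := by
  rw [payoff, surplus, investorReturn, investorReturn,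
    integral_retained_mul hH (intervalIntegrable_density he), sub_right_comm]

theorem continuousOn_payoff (hH : IsSecurity H) :
    ContinuousOn (M.payoff H) (Icc 0 M.maxEffort) :=
  (continuousOn_surplus.sub (continuousOn_investorReturn hH)).congr fun _ he =>
    payoff_eq_surplus_sub hH he

theorem hasDerivAt_payoff (hH : IsSecurity H) (he : e ∈ Ioo 0 M.maxEffort) :
    HasDerivAt (M.payoff H)
      ((∫ x in (0 : ℝ)..1, (x - H x) * M.densityDeriv x e) - M.costDeriv e) e := by
  have heI := Ioo_subset_Icc_self he
  rw [integral_retained_mul hH (intervalIntegrable_densityDeriv heI), sub_right_comm]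
  have hcost := (M.cost_hasDeriv e heI).hasDerivAt (Icc_mem_nhds he.1 he.2)
  refine (((hasDerivAt_investorReturn isSecurity_id he).sub hcost).sub
    (hasDerivAt_investorReturn hH he)).congr_of_eventuallyEq ?_
  filter_upwards [Ioo_mem_nhds he.1 he.2] with t ht
  exact payoff_eq_surplus_sub hH (Ioo_subset_Icc_self ht)

theorem optimal_of_isMaxOn_surplus {IC : (ℝ → ℝ) → ℝ → Prop} (hH : IsSecurity H)
    (he : e ∈ Icc 0 M.maxEffort) (hIC : IC H e) (hret : M.investorReturn H e = M.requiredReturn)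
    (hmax : IsMaxOn M.surplus (Icc 0 M.maxEffort) e) : M.Optimal IC H e := by
  refine ⟨⟨hH, he, hIC, hret.ge⟩, fun G t hG => ?_⟩
  rw [payoff_eq_surplus_sub hG.security hG.effort_mem, payoff_eq_surplus_sub hH he, hret]
  exact sub_le_sub (isMaxOn_iff.1 hmax t hG.effort_mem) hG.participation

theorem exists_contingentDebt_solves (hatt : M.RequiredReturnAttainable) {N : ℕ}
    (hpeak : ∀ e ∈ Icc 0 M.maxEffort,
      IsAtMostPeaked N fun x => M.densityDeriv x e / M.density x e) :
    ∃ H : ℝ → ℝ, M.SolvesProblem H ∧ ∃ k ≤ N + 1, ∃ lo hi : Fin k → ℝ,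
      IsContingentDebt H lo hi ∧ {n | NonDefaultable H lo hi n}.ncard ≤ 2 := by
  obtain ⟨e, he, hmax⟩ := isCompact_Icc.exists_isMaxOn
    (nonempty_Icc.2 M.maxEffort_pos.le) M.continuousOn_surplus
  obtain ⟨G, hG, hfoc, hret⟩ := hatt e he
  obtain ⟨n, hn, hpeaked⟩ := hpeak e he
  have hψi := M.intervalIntegrable_densityDeriv he
  obtain ⟨H, ⟨k, hk, lo, hi, hdebt, hnd⟩, hφ, hψ⟩ := hG.exists_isContingentDebt_integral_eq
    (intervalIntegrable_density he) hψi
    (fun x hx => M.density_pos x (Ioo_subset_Icc_self hx) e he) hpeaked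
  refine ⟨H, ⟨e, optimal_of_isMaxOn_surplus hdebt.security he ?_ (hφ.trans hret) hmax⟩,
    k, hk.trans (Nat.succ_le_succ hn), lo, hi, hdebt, hnd⟩
  rw [FirstOrder, integral_retained_mul hdebt.security hψi, hψ, ← integral_retained_mul hG hψi]
  exact hfoc

theorem exists_standardDebt_investorReturn_eq (he : e ∈ Icc 0 M.maxEffort) (hH : IsSecurity H)
    (hpos : 0 < M.investorReturn H e) :
    ∃ d, 0 < d ∧ M.investorReturn (standardDebt d) e = M.investorReturn H e := by
  obtain ⟨d, hd, heq⟩ := hH.exists_standardDebt_integral_eq (intervalIntegrable_density he)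
    (fun x hx => (M.density_pos x (Ioo_subset_Icc_self hx) e he).le)
    (left_mem_Icc.2 zero_le_one) (right_mem_Icc.2 zero_le_one) zero_le_one
  have hd0 : 0 ≤ d := (hH.nonneg 0 (left_mem_Icc.2 zero_le_one)).trans hd.1
  refine ⟨d, hd0.lt_of_ne ?_, heq⟩
  rintro rfl
  refine hpos.ne (Eq.trans ?_ heq)
  rw [intervalIntegral.integral_congr_Ioo_of_le (g := fun _ => 0) zero_le_one fun x hx => by
    simp only [standardDebt, min_eq_right hx.1.le, zero_mul], intervalIntegral.integral_zero]

namespace MLRP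

theorem monotoneOn_densityDeriv_div_density (h : M.MLRP) (he : e ∈ Ioo 0 M.maxEffort) :
    MonotoneOn (fun x => M.densityDeriv x e / M.density x e) (Icc 0 1) := by
  have heI : e ∈ Icc 0 M.maxEffort := Ioo_subset_Icc_self he
  have hslope (x : ℝ) (hx : x ∈ Icc (0 : ℝ) 1) :
      Filter.Tendsto (slope (fun t => M.density x t / M.density x e) e) (nhdsWithin e (Ioi e))
        (nhds (M.densityDeriv x e / M.density x e)) :=
    (hasDerivWithinAt_iff_tendsto_slope' self_notMem_Ioi).1
      (((M.density_hasDeriv x hx e heI).hasDerivAt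
        (Icc_mem_nhds he.1 he.2)).div_const _).hasDerivWithinAt
  intro x hx y hy hxy
  refine le_of_tendsto_of_tendsto (hslope x hx) (hslope y hy) ?_
  filter_upwards [Ioo_mem_nhdsGT he.2] with t ht
  have hmono := h e heI t ⟨he.1.le.trans ht.1.le, ht.2.le⟩ ht.1.le hx hy hxy
  simp only [slope_def_field, div_self (M.density_pos x hx e heI).ne',
    div_self (M.density_pos y hy e heI).ne']
  exact div_le_div_of_nonneg_right (sub_le_sub_right hmono 1) (sub_nonneg.2 ht.1.le)

theorem integral_mul_densityDeriv_nonneg (h : M.MLRP) (he : e ∈ Ioo 0 M.maxEffort)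
    (hφ : IntervalIntegrable (fun x => D x * M.density x e) volume 0 1)
    (hψ : IntervalIntegrable (fun x => D x * M.densityDeriv x e) volume 0 1)
    (hcross : SingleCrossingOn
      (fun x => D x - ∫ y in (0 : ℝ)..1, D y * M.density y e) (Icc 0 1)) :
    0 ≤ ∫ x in (0 : ℝ)..1, D x * M.densityDeriv x e := by
  have heI := Ioo_subset_Icc_self he
  set mean := ∫ y in (0 : ℝ)..1, D y * M.density y e with hmean
  have hmφ := (intervalIntegrable_density heI).const_mul mean
  have hmψ := (intervalIntegrable_densityDeriv heI).const_mul mean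
  have hnonneg := SingleCrossingOn.integral_mul_nonneg (ψ := fun x => M.densityDeriv x e)
    (fun x hx y hy => hcross x (Ioo_subset_Icc_self hx) y (Ioo_subset_Icc_self hy)) zero_le_one
    (fun x hx => M.density_pos x (Ioo_subset_Icc_self hx) e heI)
    ((h.monotoneOn_densityDeriv_div_density he).mono Ioo_subset_Icc_self)
    (by simpa only [sub_mul] using hφ.sub hmφ) (by simpa only [sub_mul] using hψ.sub hmψ)
    (by simp only [sub_mul, intervalIntegral.integral_sub hφ hmφ,
      intervalIntegral.integral_const_mul, M.density_integral e heI, ← hmean, mul_one, sub_self])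
  simpa only [sub_mul, intervalIntegral.integral_sub hψ hmψ, intervalIntegral.integral_const_mul,
    integral_densityDeriv_eq_zero he, mul_zero, sub_zero] using hnonneg

theorem monotoneOn_investorReturn (h : M.MLRP) (hH : IsSecurity H) :
    MonotoneOn (M.investorReturn H) (Icc 0 M.maxEffort) := by
  refine monotoneOn_of_hasDerivWithinAt_nonneg (convex_Icc _ _) (continuousOn_investorReturn hH)
    (f' := fun e => ∫ x in (0 : ℝ)..1, H x * M.densityDeriv x e) (fun e he => ?_) fun e he => ?_
  all_goals rw [interior_Icc] at he
  · exact (hasDerivAt_investorReturn hH he).hasDerivWithinAt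
  · have heI := Ioo_subset_Icc_self he
    exact h.integral_mul_densityDeriv_nonneg he (intervalIntegrable_mul_density hH.mono heI)
      (intervalIntegrable_mul_densityDeriv hH.mono heI)
      fun x hx y hy hxy hpos => hpos.le.trans (sub_le_sub_right (hH.mono hx hy hxy) _)

theorem costDeriv_le_integral_standardDebt (h : M.MLRP) (he : e ∈ Ioo 0 M.maxEffort)
    (hK : IsSecurity K) (hfoc : M.FirstOrder K e) (hd : 0 ≤ d)
    (hle : M.investorReturn (standardDebt d) e ≤ M.investorReturn K e) :
    M.costDeriv e ≤ ∫ x in (0 : ℝ)..1, (x - standardDebt d x) * M.densityDeriv x e := by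
  have heI := Ioo_subset_Icc_self he
  have hD := isSecurity_standardDebt hd
  have h0 : (0 : ℝ) ∈ Icc (0 : ℝ) 1 := left_mem_Icc.2 zero_le_one
  have h1 : (1 : ℝ) ∈ Icc (0 : ℝ) 1 := right_mem_Icc.2 zero_le_one
  have hφi := intervalIntegrable_density heI
  have hψi := intervalIntegrable_densityDeriv heI
  have hint {w : ℝ → ℝ} (hw : IntervalIntegrable w volume 0 1) :
      IntervalIntegrable (fun x => (K x - standardDebt d x) * w x) volume 0 1 := by
    simpa only [sub_mul] using
      (hK.intervalIntegrable_mul hw h0 h1).sub (hD.intervalIntegrable_mul hw h0 h1)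
  have hexcess := h.integral_mul_densityDeriv_nonneg he (hint hφi) (hint hψi) (by
    rw [hK.integral_sub_mul hD hφi h0 h1]
    simpa only [sub_sub, investorReturn] using
      hK.singleCrossingOn_sub_standardDebt (sub_nonneg.2 hle) d)
  rw [hK.integral_sub_mul hD hψi h0 h1] at hexcess
  rw [FirstOrder, integral_retained_mul hK hψi] at hfoc
  rw [integral_retained_mul hD hψi]
  linarith

theorem monotoneOn_payoff_standardDebt (h : M.MLRP) (hatt : M.RequiredReturnAttainable)
    (hd : 0 ≤ d) (hret : M.investorReturn (standardDebt d) M.maxEffort ≤ M.requiredReturn) :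
    MonotoneOn (M.payoff (standardDebt d)) (Icc 0 M.maxEffort) := by
  have hD := isSecurity_standardDebt hd
  refine monotoneOn_of_hasDerivWithinAt_nonneg (convex_Icc _ _) (continuousOn_payoff hD)
    (f' := fun e => (∫ x in (0 : ℝ)..1, (x - standardDebt d x) * M.densityDeriv x e)
      - M.costDeriv e) (fun e he => ?_) fun e he => ?_
  all_goals rw [interior_Icc] at he
  · exact (hasDerivAt_payoff hD he).hasDerivWithinAt
  · have heI := Ioo_subset_Icc_self he
    obtain ⟨K, hK, hfoc, hKret⟩ := hatt e heI
    refine sub_nonneg.2 (h.costDeriv_le_integral_standardDebt he hK hfoc hd ?_)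
    calc M.investorReturn (standardDebt d) e
        ≤ M.investorReturn (standardDebt d) M.maxEffort :=
          h.monotoneOn_investorReturn hD heI (right_mem_Icc.2 M.maxEffort_pos.le) he.2.le
      _ ≤ M.investorReturn K e := hret.trans_eq hKret.symm

theorem exists_standardDebt_solves (h : M.MLRP) (hatt : M.RequiredReturnAttainable) :
    ∃ d : ℝ, 0 < d ∧ M.SolvesBestResponseProblem (standardDebt d) ∧
      (M.FirstOrderNecessary → M.SolvesProblem (standardDebt d)) := by
  have htop : M.maxEffort ∈ Icc 0 M.maxEffort := right_mem_Icc.2 M.maxEffort_pos.le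
  obtain ⟨G, hG, -, hGret⟩ := hatt M.maxEffort htop
  obtain ⟨d, hd, hdG⟩ := exists_standardDebt_investorReturn_eq htop hG
    (M.requiredReturn_pos.trans_eq hGret.symm)
  have hret := hdG.trans hGret
  have hD := isSecurity_standardDebt hd.le
  have hpayoff := h.monotoneOn_payoff_standardDebt hatt hd.le hret.le
  have hbest : M.BestResponse (standardDebt d) M.maxEffort :=
    ⟨htop, fun t ht => hpayoff ht htop ht.2⟩
  have hmax : IsMaxOn M.surplus (Icc 0 M.maxEffort) M.maxEffort := isMaxOn_iff.2 fun t ht => by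
    have hpt := hpayoff ht htop ht.2
    rw [payoff_eq_surplus_sub hD ht, payoff_eq_surplus_sub hD htop] at hpt
    linarith [h.monotoneOn_investorReturn hD ht htop ht.2]
  exact ⟨d, hd, ⟨_, optimal_of_isMaxOn_surplus hD htop hbest hret hmax⟩, fun hnec =>
    ⟨_, optimal_of_isMaxOn_surplus hD htop (hnec _ _ hD hbest) hret hmax⟩⟩

end MLRP

end Model

end SecurityDesign

theorem proposition4_general (M : SecurityDesign.Model)
    (hatt : M.RequiredReturnAttainable) :
    (∀ N : ℕ,
      (∀ e ∈ Set.Icc 0 M.maxEffort,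
        SecurityDesign.IsAtMostPeaked N (fun x => M.densityDeriv x e / M.density x e)) →
      ∃ H : ℝ → ℝ, M.SolvesProblem H ∧
        ∃ k ≤ N + 1, ∃ lo hi : Fin k → ℝ,
          SecurityDesign.IsContingentDebt H lo hi ∧
          {n | SecurityDesign.NonDefaultable H lo hi n}.ncard ≤ 2) ∧
    (M.MLRP →
      ∃ d : ℝ, 0 < d ∧ M.SolvesBestResponseProblem (SecurityDesign.standardDebt d) ∧
        (M.FirstOrderNecessary → M.SolvesProblem (SecurityDesign.standardDebt d))) :=
  ⟨fun _ hpeak => SecurityDesign.Model.exists_contingentDebt_solves hatt hpeak,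
    fun h => h.exists_standardDebt_solves hatt⟩

theorem proposition4 (M : SecurityDesign.Model) (hInt : M.RequiredReturnInterior) :
    (∀ N : ℕ,
      (∀ e ∈ Set.Icc 0 M.maxEffort,
        SecurityDesign.IsAtMostPeaked N (fun x => M.densityDeriv x e / M.density x e)) →
      ∃ H : ℝ → ℝ, M.SolvesProblem H ∧
        ∃ k ≤ N + 1, ∃ lo hi : Fin k → ℝ,
          SecurityDesign.IsContingentDebt H lo hi ∧
          {n | SecurityDesign.NonDefaultable H lo hi n}.ncard ≤ 2) ∧
    (M.MLRP →
      ∃ d : ℝ, 0 < d ∧ M.SolvesBestResponseProblem (SecurityDesign.standardDebt d) ∧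
        (M.FirstOrderNecessary → M.SolvesProblem (SecurityDesign.standardDebt d))) :=
  proposition4_general M fun e he => (interior_subset (hInt e he) :)
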